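/- **Setting.** Let $\phi_A:\mathcal A\to\mathcal H_A$, $\phi_B:\mathcal B\to\mathcal H_B$, $\phi_C:\mathcal C\to\mathcal H_C$ be (strongly) measurable feature maps into real Hilbert spaces, and let $\hat\mu_{A|C}:\mathcal C\to\mathcal H_A$, $\hat\mu_{B|C}:\mathcal C\to\mathcal H_B$ be fixed (strongly) measurable maps (the estimated conditional mean embeddings). For $x=(a,b,c)$, $x'=(a',b',c')$ put $$\hat h(x,x')=\langle\phi_C(c),\phi_C(c')\rangle\,\langle\phi_A(a)-\hat\mu_{A|C}(c),\,\phi_A(a')-\hat\mu_{A|C}(c')\rangle\,\langle\phi_B(b)-\hat\mu_{B|C}(c),\,\phi_B(b')-\hat\mu_{B|C}(c')\rangle .$$ Let $P$ be the law of $(A,B,C)$, assume the null hypothesis that $A$ and $B$ are conditionally independent given $C$ (that is, $E[f(A,C)g(B,C)\mid C]=E[f(A,C)\mid C]\,E[g(B,C)\mid C]$ a.s. for all square-integrable $f(A,C)$, $g(B,C)$), and assume $\hat h\in L^2(P\otimes P)$. Let $X_1,\dots,X_n$ be i.i.d. with law $P$, put $\hat h_{ij}=\hat h(X_i,X_j)$,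 $$\widehat{\mathrm{KCI}}_n=\frac1{n(n-1)}\sum_{i\ne j}\hat h_{ij},\qquad \widehat{\mathrm{KCI}}=\int\!\!\int \hat h\,dP\,dP,$$ assume $\mathrm{Var}(\widehat{\mathrm{KCI}}_n)>0$, and let $Z_n\sim\mathcal N(\widehat{\mathrm{KCI}},\mathrm{Var}(\widehat{\mathrm{KCI}}_n))$. Let $\varepsilon_1,\dots,\varepsilon_n$ be i.i.d. $\mathcal N(0,1)$, independent of $(X_1,\dots,X_n)$. For a real $n\times n$ matrix $M$ with singular values $\sigma_1,\dots,\sigma_n$ write $\|M\|_p=(\sum_r\sigma_r^p)^{1/p}$ for $p<\infty$ and $\|M\|_\infty=\max_r\sigma_r$ (Schatten norms). Consider either of the two conventions for the wild bootstrap variable $Y$ and its matrix $\hat H$: (i) $\hat H=(\hat h_{ij})_{i,j}$ is the full kernel matrix and $Y=\frac1n\sum_{i,j=1}^n\hat h_{ij}\,(\varepsilon_i\varepsilon_j-\mathbf 1\{i=j\})$, the quadratic form $\frac1n\sum_{i,j}\hat h_{ij}\varepsilon_i\varepsilon_j$ centered at its conditional mean $\frac1n\mathrm{tr}\,\hat H$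 given $\hat H$; (ii) $\hat H$ has entries $\hat h_{ij}$ for $i\ne j$ and zero diagonal, and $Y=\frac1n\sum_{i\ne j}\hat h_{ij}\,\varepsilon_i\varepsilon_j$. Where $\hat H\ne0$, put $$\delta=\frac{\|\hat H\|_\infty^2}{\|\hat H\|_2^2},\quad b=\frac{\widehat{\mathrm{KCI}}}{\sqrt{\mathrm{Var}(\widehat{\mathrm{KCI}}_n)}},\quad k=\frac{\mathrm{Var}(Y\mid\hat H)}{n^2\,\mathrm{Var}(\widehat{\mathrm{KCI}}_n)},$$ $$R_1=\tfrac43\sqrt2\,\pi^2\,\frac{\|\hat H\|_3^3}{\|\hat H\|_2^3},\quad R_2=\frac{2^{-5/4}\pi^{-2}}{\sqrt{1-2\delta}},\quad R_3=(2\pi)^{-7/2},\quad \Psi(x)=\frac1{\sqrt{2\pi}}\,x\,e^{2\pi x}.$$ **Theorem.** In both conventions, almost surely, if $\hat H\ne0$ and $\delta<1/2$, then $$\sup_{x\in\mathbb R}\bigl|\Pr(Y\le x\mid\hat H)-\Pr(nZ_n\le x)\bigr|\;\le\;\Psi\bigl(R_1k^{3/2}+b+\pi|k-1|\bigr)+R_2\,k^{-1/2}+R_3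 .$$ In convention (i), moreover, $R_1=\frac{2\pi^2}{3}\,\mathrm{Skew}(Y\mid\hat H)$, the conditional skewness. -/

import Mathlib

open MeasureTheory ProbabilityTheory

noncomputable section

namespace KCI

/-- Conditional independence of the coordinates `A` and `B` given the coordinate `C` under the
joint law `P` of `(A, B, C)`: conditional expectations of products of square-integrable functions
of `(A, C)` and of `(B, C)` factorize. -/
def CondIndepGiven {𝒜 ℬ 𝒞 : Type*} [MeasurableSpace 𝒜] [MeasurableSpace ℬ] [MeasurableSpace 𝒞]
    (P : Measure (𝒜 × ℬ × 𝒞)) : Prop :=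
  ∀ (f : 𝒜 × 𝒞 → ℝ) (g : ℬ × 𝒞 → ℝ), Measurable f → Measurable g →
    MemLp (fun x : 𝒜 × ℬ × 𝒞 => f (x.1, x.2.2)) 2 P →
    MemLp (fun x : 𝒜 × ℬ × 𝒞 => g (x.2.1, x.2.2)) 2 P →
    P[fun x => f (x.1, x.2.2) * g (x.2.1, x.2.2) |
        MeasurableSpace.comap (fun x : 𝒜 × ℬ × 𝒞 => x.2.2) inferInstance]
      =ᵐ[P] fun x =>
        (P[fun x => f (x.1, x.2.2) |
          MeasurableSpace.comap (fun x : 𝒜 × ℬ × 𝒞 => x.2.2) inferInstance]) x *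
        (P[fun x => g (x.2.1, x.2.2) |
          MeasurableSpace.comap (fun x : 𝒜 × ℬ × 𝒞 => x.2.2) inferInstance]) x

/-- The kernel `ĥ(x, x') = k_C(c, c') ⟪φ_A(a) - μ̂_A(c), φ_A(a') - μ̂_A(c')⟫
⟪φ_B(b) - μ̂_B(c), φ_B(b') - μ̂_B(c')⟫` at `x = (a, b, c)`, `x' = (a', b', c')`, where
`k_C(c, c') = ⟪φ_C(c), φ_C(c')⟫`. -/
def hHat {𝒜 ℬ 𝒞 HA HB HC : Type*}
    [NormedAddCommGroup HA] [InnerProductSpace ℝ HA]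
    [NormedAddCommGroup HB] [InnerProductSpace ℝ HB]
    [NormedAddCommGroup HC] [InnerProductSpace ℝ HC]
    (φA : 𝒜 → HA) (φB : ℬ → HB) (φC : 𝒞 → HC) (muA : 𝒞 → HA) (muB : 𝒞 → HB)
    (x x' : 𝒜 × ℬ × 𝒞) : ℝ :=
  inner ℝ (φC x.2.2) (φC x'.2.2)
    * inner ℝ (φA x.1 - muA x.2.2) (φA x'.1 - muA x'.2.2)
    * inner ℝ (φB x.2.1 - muB x.2.2) (φB x'.2.1 - muB x'.2.2)

/-- The U-statistic `1 / (n (n - 1)) * ∑_{i ≠ j} h (x i) (x j)`. -/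
def uStat {𝒳 : Type*} (h : 𝒳 → 𝒳 → ℝ) {n : ℕ} (x : Fin n → 𝒳) : ℝ :=
  1 / ((n : ℝ) * ((n : ℝ) - 1)) * ∑ i, ∑ j, if i ≠ j then h (x i) (x j) else 0

/-- The population value `E[h(X, X')]` for independent `X, X' ∼ P`. -/
def population {𝒳 : Type*} [MeasurableSpace 𝒳] (h : 𝒳 → 𝒳 → ℝ) (P : Measure 𝒳) : ℝ :=
  ∫ z, h z.1 z.2 ∂(P.prod P)

/-- The matrix with entries `h (x i) (x j)`. -/
def gram {𝒳 : Type*} (h : 𝒳 → 𝒳 → ℝ) {n : ℕ} (x : Fin n → 𝒳) : Matrix (Fin n) (Fin n) ℝ :=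
  Matrix.of fun i j => h (x i) (x j)

/-- The matrix with entries `h (x i) (x j)` off the diagonal and `0` on the diagonal. -/
def gramOff {𝒳 : Type*} (h : 𝒳 → 𝒳 → ℝ) {n : ℕ} (x : Fin n → 𝒳) :
    Matrix (Fin n) (Fin n) ℝ :=
  Matrix.of fun i j => if i ≠ j then h (x i) (x j) else 0

/-- The wild bootstrap variable `1 / n * ∑_{i, j} M i j * (e i * e j - 1{i = j})`, that is, the
quadratic form centered at its mean under i.i.d. standard Gaussian `e`. -/
def wildBootstrap {n : ℕ} (M : Matrix (Fin n) (Fin n) ℝ) (e : Fin n → ℝ) : ℝ :=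
  1 / (n : ℝ) * ∑ i, ∑ j, M i j * (e i * e j - if i = j then 1 else 0)

/-- The wild bootstrap variable without diagonal terms, `1 / n * ∑_{i ≠ j} M i j * e i * e j`. -/
def wildBootstrapOff {n : ℕ} (M : Matrix (Fin n) (Fin n) ℝ) (e : Fin n → ℝ) : ℝ :=
  1 / (n : ℝ) * ∑ i, ∑ j, if i ≠ j then M i j * e i * e j else 0

/-- The conditional law of the random variable `Y` given the random matrix `H`, at the value
`H ω` of the matrix. -/
def condLaw {Ω : Type*} [MeasurableSpace Ω] {n : ℕ} (Y : Ω → ℝ)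
    (H : Ω → Matrix (Fin n) (Fin n) ℝ) (ρ : Measure Ω) [IsFiniteMeasure ρ] (ω : Ω) : Measure ℝ :=
  condDistrib Y (fun (ω' : Ω) (i j : Fin n) => H ω' i j) ρ (fun i j => H ω i j)

/-- The singular values of a real square matrix. -/
def singVal {n : ℕ} (M : Matrix (Fin n) (Fin n) ℝ) (r : Fin n) : ℝ :=
  √((Matrix.isHermitian_conjTranspose_mul_self M).eigenvalues r)

/-- The Schatten `p`-norm, for `1 ≤ p < ∞`. -/
def schatten {n : ℕ} (p : ℝ) (M : Matrix (Fin n) (Fin n) ℝ) : ℝ :=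
  (∑ r, singVal M r ^ p) ^ (1 / p)

/-- The Schatten `∞`-norm: the largest singular value. -/
def schattenTop {n : ℕ} (M : Matrix (Fin n) (Fin n) ℝ) : ℝ :=
  ⨆ r, singVal M r

/-- `δ = ‖M‖_∞² / ‖M‖_2²`. -/
def delta {n : ℕ} (M : Matrix (Fin n) (Fin n) ℝ) : ℝ :=
  schattenTop M ^ 2 / schatten 2 M ^ 2

/-- The skewness of a probability law on the real line. -/
def skewness (μ : Measure ℝ) : ℝ :=
  (∫ y, (y - ∫ z, z ∂μ) ^ 3 ∂μ) / Var[id; μ] ^ (3 / 2 : ℝ)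

/-- The Kolmogorov distance of two laws on the real line. -/
def kolmogorovDist (μ ν : Measure ℝ) : ℝ :=
  ⨆ x : ℝ, |μ.real (Set.Iic x) - ν.real (Set.Iic x)|

/-- The standardized mean shift, from the mean `m` and the variance `v` of the statistic. -/
def meanShift (m v : ℝ) : ℝ := m / √v

/-- The variance mismatch, from the conditional law `μ` of the wild bootstrap variable and the
variance `v` of the statistic. -/
def varMismatch (n : ℕ) (μ : Measure ℝ) (v : ℝ) : ℝ := Var[id; μ] / ((n : ℝ) ^ 2 * v)

def R₁ {n : ℕ} (M : Matrix (Fin n) (Fin n) ℝ) : ℝ :=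
  4 / 3 * √2 * Real.pi ^ 2 * schatten 3 M ^ 3 / schatten 2 M ^ 3

def R₂ (δ : ℝ) : ℝ := (2 : ℝ) ^ (-(5 / 4) : ℝ) * Real.pi ^ (-2 : ℝ) / √(1 - 2 * δ)

def R₃ : ℝ := (2 * Real.pi) ^ (-(7 / 2) : ℝ)

def Psi (x : ℝ) : ℝ := 1 / √(2 * Real.pi) * x * Real.exp (2 * Real.pi * x)

end KCI

end

/-! Condition on the data, so that the kernel matrix is a fixed symmetric matrix with eigenvalues `λ
r`. By rotation invariance of the standard Gaussian, the centered quadratic form has the law of `∑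
(λ r / n) (ξ r ^ 2 - 1)` with i.i.d. standard normal `ξ r` (`map_wildBootstrap`). Both conventions
are of this type: with zero diagonal the trace vanishes and no centering is needed. Dividing by `n
√v` turns the target into `N(b, 1)`, the weights into `τ r`, and the variance into `k = 2 ∑ τ r ^
2`.

The two laws are compared through characteristic functions. The difference of distribution functions
has Fourier transform `(φ - ψ) / (i s)`, up to the sign of the frequency, so inversion bounds the
Kolmogorov distance by `(1 / 2π) ∫ |φ - ψ| / |s|` (`abs_cdf_sub_le`). The integral is split at `|s|
= 2π`.

For `|s| ≤ 2π` the exponents differ by at most `|s| x`, where `x = R₁ k ^ (3/2) + b + π |k - 1|`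
collects the cubic Taylor remainder of the logarithm, the mean shift and the variance mismatch. The
factor `|s|` cancels the singularity at `0`, and the remaining Gaussian integral gives `Ψ(x)`. For
`|s| > 2π` each function is bounded separately. If no weight dominates (`δ < 1/2`), the second-order
term of `∏ (1 + 4 τ r ^ 2 s ^ 2)` forces `|φ| ≤ C / |s|`, which gives `R₂ k ^ (-1/2)`; the Gaussian
tail gives `R₃`.

The shift `b` is nonnegative because the kernel is the inner product of a feature map with itself
(`integral_inner_self_nonneg`). Singular values enter as the `|λ r|` (`sum_singVal`), and for a
positive semidefinite matrix `∑ |λ r| ^ 3` is the third cumulant up to a constant, whence the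
skewness formula. -/

/-! ### Fourier bound for the difference of two distribution functions. -/

/-- `1{y ≤ x} - 1{z ≤ x}` for `p = (y, z)`. -/
noncomputable def stepDiff (p : ℝ × ℝ) (x : ℝ) : ℂ :=
  (Set.Ici p.1).indicator (fun _ => 1) x - (Set.Ici p.2).indicator (fun _ => 1) x

lemma stepDiff_of_le {y z : ℝ} (hyz : y ≤ z) :
    stepDiff (y, z) = (Set.Ico y z).indicator (fun _ => 1) := by
  ext x
  simp only [stepDiff, Set.indicator, Set.mem_Ici, Set.mem_Ico]
  grind

lemma stepDiff_swap (y z x : ℝ) : stepDiff (z, y) x = - stepDiff (y, z) x := by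
  simp [stepDiff]

lemma measurable_stepDiff : Measurable (Function.uncurry stepDiff) := by
  have h1 : MeasurableSet {q : (ℝ × ℝ) × ℝ | q.1.1 ≤ q.2} :=
    measurableSet_le (by fun_prop) (by fun_prop)
  have h2 : MeasurableSet {q : (ℝ × ℝ) × ℝ | q.1.2 ≤ q.2} :=
    measurableSet_le (by fun_prop) (by fun_prop)
  have e : Function.uncurry stepDiff = fun q : (ℝ × ℝ) × ℝ =>
      {q : (ℝ × ℝ) × ℝ | q.1.1 ≤ q.2}.indicator (fun _ => (1 : ℂ)) q -
      {q : (ℝ × ℝ) × ℝ | q.1.2 ≤ q.2}.indicator (fun _ => (1 : ℂ)) q := by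
    ext q
    simp [Function.uncurry, stepDiff, Set.indicator]
  rw [e]
  exact (measurable_const.indicator h1).sub (measurable_const.indicator h2)

lemma integrable_stepDiff (p : ℝ × ℝ) : Integrable (stepDiff p) := by
  obtain ⟨y, z⟩ := p
  have key : ∀ y z : ℝ, y ≤ z → Integrable (stepDiff (y, z)) := by
    intro y z hyz
    rw [stepDiff_of_le hyz]
    exact (integrable_indicator_iff measurableSet_Ico).2 (integrableOn_const (by simp))
  rcases le_total y z with h | h
  · exact key y z h
  · have e : stepDiff (y, z) = fun x => - stepDiff (z, y) x := funext fun x => stepDiff_swap z y x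
    rw [e]
    exact (key z y h).neg

lemma integral_norm_stepDiff (p : ℝ × ℝ) : ∫ x, ‖stepDiff p x‖ = |p.1 - p.2| := by
  obtain ⟨y, z⟩ := p
  have key : ∀ y z : ℝ, y ≤ z → ∫ x, ‖stepDiff (y, z) x‖ = |y - z| := by
    intro y z hyz
    rw [stepDiff_of_le hyz]
    simp only [norm_indicator_eq_indicator_norm, norm_one]
    rw [integral_indicator measurableSet_Ico]
    simp [abs_sub_comm y z, abs_of_nonneg (sub_nonneg.2 hyz), hyz]
  rcases le_total y z with h | h
  · exact key y z h
  · rw [abs_sub_comm, ← key z y h]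
    exact integral_congr_ae (.of_forall fun x => by simp [stepDiff_swap z y x])

lemma integral_exp_mul_stepDiff (p : ℝ × ℝ) {s : ℝ} (hs : s ≠ 0) :
    ∫ x : ℝ, Complex.exp (-(s * x) * Complex.I) * stepDiff p x =
      (Complex.exp (-(s * p.1) * Complex.I) - Complex.exp (-(s * p.2) * Complex.I))
        / (s * Complex.I) := by
  obtain ⟨y, z⟩ := p
  have hs' : (s : ℂ) * Complex.I ≠ 0 := by simp [hs]
  have key : ∀ y z : ℝ, y ≤ z →
      ∫ x : ℝ, Complex.exp (-(s * x) * Complex.I) * stepDiff (y, z) x =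
      (Complex.exp (-(s * y) * Complex.I) - Complex.exp (-(s * z) * Complex.I))
        / (s * Complex.I) := by
    intro y z hyz
    rw [stepDiff_of_le hyz]
    have e : (fun x : ℝ => Complex.exp (-(s * x) * Complex.I) *
        (Set.Ico y z).indicator (fun _ => (1 : ℂ)) x) =
        (Set.Ico y z).indicator fun x : ℝ => Complex.exp ((-(s * Complex.I)) * x) := by
      ext x
      by_cases hx : x ∈ Set.Ico y z <;> simp [hx]
      ring_nf
    rw [e, integral_indicator measurableSet_Ico, integral_Ico_eq_integral_Ioc,
      ← intervalIntegral.integral_of_le hyz, integral_exp_mul_complex (neg_ne_zero.2 hs'),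
      div_neg, ← neg_div, neg_sub]
    congr 3 <;> ring_nf
  rcases le_total y z with h | h
  · exact key y z h
  · have e : ∀ x, stepDiff (y, z) x = - stepDiff (z, y) x := fun x => stepDiff_swap z y x
    simp only [e, mul_neg, integral_neg, key z y h]
    rw [← neg_div, neg_sub]

/-- A single step function is not integrable in `x`, but the difference of two has `L¹` norm `|y -
z|`. Coupling the laws by their product measure therefore reduces Fubini to finite first moments. -/
lemma integrable_stepDiff_prod (μ ν : Measure ℝ) [IsProbabilityMeasure μ] [IsProbabilityMeasure ν]
    (hμ : Integrable id μ) (hν : Integrable id ν) :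
    Integrable (Function.uncurry stepDiff) ((μ.prod ν).prod volume) := by
  rw [integrable_prod_iff measurable_stepDiff.aestronglyMeasurable]
  refine ⟨.of_forall fun p => integrable_stepDiff p, ?_⟩
  simp only [Function.uncurry_apply_pair, integral_norm_stepDiff]
  exact (hμ.comp_fst ν |>.sub (hν.comp_snd μ)).abs

lemma integral_stepDiff (μ ν : Measure ℝ) [IsProbabilityMeasure μ] [IsProbabilityMeasure ν]
    (x : ℝ) :
    ∫ p, stepDiff p x ∂(μ.prod ν) = ((μ.real (Set.Iic x) - ν.real (Set.Iic x) : ℝ) : ℂ) := by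
  have e : ∀ p : ℝ × ℝ, stepDiff p x = (Set.Iic x).indicator (fun _ => (1 : ℂ)) p.1 -
      (Set.Iic x).indicator (fun _ => (1 : ℂ)) p.2 := fun p => by
    simp [stepDiff, Set.indicator]
  have hi : ∀ η : Measure ℝ, [IsProbabilityMeasure η] →
      Integrable ((Set.Iic x).indicator (fun _ => (1 : ℂ))) η := fun η _ =>
    (integrable_const _).indicator measurableSet_Iic
  simp only [e]
  have hv : ∀ η : Measure ℝ, [IsProbabilityMeasure η] →
      ∫ y, (Set.Iic x).indicator (fun _ => (1 : ℂ)) y ∂η = (η.real (Set.Iic x) : ℂ) := fun η _ => by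
    rw [integral_indicator measurableSet_Iic]
    simp
  rw [integral_sub ((hi μ).comp_fst ν) ((hi ν).comp_snd μ), integral_fun_fst, integral_fun_snd,
    hv, hv]
  simp

open scoped FourierTransform

lemma integrable_cdf_sub (μ ν : Measure ℝ) [IsProbabilityMeasure μ] [IsProbabilityMeasure ν]
    (hμ : Integrable id μ) (hν : Integrable id ν) :
    Integrable fun x => ((μ.real (Set.Iic x) - ν.real (Set.Iic x) : ℝ) : ℂ) := by
  simp only [← integral_stepDiff]
  exact (integrable_stepDiff_prod μ ν hμ hν).integral_prod_right

lemma fourier_cdf_sub (μ ν : Measure ℝ) [IsProbabilityMeasure μ] [IsProbabilityMeasure ν]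
    (hμ : Integrable id μ) (hν : Integrable id ν) {w : ℝ} (hw : w ≠ 0) :
    𝓕 (fun x => ((μ.real (Set.Iic x) - ν.real (Set.Iic x) : ℝ) : ℂ)) w =
      (charFun μ (-(2 * Real.pi * w)) - charFun ν (-(2 * Real.pi * w)))
        / ((2 * Real.pi * w : ℝ) * Complex.I) := by
  have hs : 2 * Real.pi * w ≠ 0 := by positivity
  set s := 2 * Real.pi * w with hsdef
  rw [Real.fourier_real_eq_integral_exp_smul]
  have e1 : ∀ x : ℝ, Complex.exp (((-2 * Real.pi * x * w : ℝ) : ℂ) * Complex.I) •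
      ((μ.real (Set.Iic x) - ν.real (Set.Iic x) : ℝ) : ℂ) =
      ∫ p, Complex.exp (-(s * x) * Complex.I) * stepDiff p x ∂(μ.prod ν) := by
    intro x
    rw [integral_const_mul, integral_stepDiff, smul_eq_mul]
    congr 3
    push_cast [hsdef]
    ring
  have hint : Integrable (Function.uncurry fun (p : ℝ × ℝ) (x : ℝ) =>
      Complex.exp (-(s * x) * Complex.I) * stepDiff p x) ((μ.prod ν).prod volume) := by
    refine (integrable_stepDiff_prod μ ν hμ hν).bdd_mul (c := 1)
      (f := fun q : (ℝ × ℝ) × ℝ => Complex.exp (-(s * q.2) * Complex.I)) ?_ (.of_forall ?_)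
    · exact (by fun_prop : Continuous _).aestronglyMeasurable
    · intro q
      rw [show (-(s * q.2 : ℂ)) = ((-(s * q.2) : ℝ) : ℂ) by push_cast; ring,
        Complex.norm_exp_ofReal_mul_I]
  simp only [e1]
  rw [← integral_integral_swap hint]
  simp only [integral_exp_mul_stepDiff _ hs]
  have hexp : ∀ η : Measure ℝ, [IsProbabilityMeasure η] →
      Integrable (fun y : ℝ => Complex.exp (-(s * y) * Complex.I)) η := fun η _ => by
    refine Integrable.of_bound (by fun_prop) 1 (.of_forall fun y => ?_)
    rw [show (-(s * y : ℂ)) = ((-(s * y) : ℝ) : ℂ) by push_cast; ring,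
        Complex.norm_exp_ofReal_mul_I]
  rw [integral_div, integral_sub ((hexp μ).comp_fst ν) ((hexp ν).comp_snd μ), integral_fun_fst
    (f := fun y : ℝ => Complex.exp (-(s * y) * Complex.I)), integral_fun_snd
    (f := fun y : ℝ => Complex.exp (-(s * y) * Complex.I)), charFun_apply_real,
    charFun_apply_real]
  simp

/-- Fourier-analytic bound on the difference of two distribution functions. -/
theorem abs_cdf_sub_le (μ ν : Measure ℝ) [IsProbabilityMeasure μ] [IsProbabilityMeasure ν]
    (hμ : Integrable id μ) (hν : Integrable id ν) {g : ℝ → ℝ} (hg : Integrable g)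
    (hb : ∀ s, s ≠ 0 → ‖charFun μ s - charFun ν s‖ / |s| ≤ g s) (x : ℝ) :
    |μ.real (Set.Iic x) - ν.real (Set.Iic x)| ≤ 1 / (2 * Real.pi) * ∫ s, g s := by
  set D : ℝ → ℂ := fun x => ((μ.real (Set.Iic x) - ν.real (Set.Iic x) : ℝ) : ℂ) with hD
  have hDint : Integrable D := integrable_cdf_sub μ ν hμ hν
  have h2 : (-(2 * Real.pi)) ≠ 0 := by simp [Real.pi_ne_zero]
  have hg' : Integrable fun w : ℝ => g (-(2 * Real.pi) * w) := hg.comp_mul_left' h2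
  have hbound : ∀ᵐ w : ℝ, ‖𝓕 D w‖ ≤ g (-(2 * Real.pi) * w) := by
    have : ∀ᵐ w : ℝ, w ≠ 0 := by simp [ae_iff, measure_singleton]
    filter_upwards [this] with w hw
    rw [fourier_cdf_sub μ ν hμ hν hw]
    have hs : -(2 * Real.pi) * w ≠ 0 := mul_ne_zero h2 hw
    refine le_trans (le_of_eq ?_) (hb _ hs)
    rw [norm_div, norm_mul, Complex.norm_I, mul_one, Complex.norm_real, Real.norm_eq_abs,
      neg_mul, abs_neg]
  have hcont : Continuous (𝓕 D) := VectorFourier.fourierIntegral_continuous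
    Real.continuous_fourierChar (by exact continuous_inner) hDint
  have hFint : Integrable (𝓕 D) := hg'.mono' hcont.aestronglyMeasurable hbound
  -- Pointwise Fourier inversion is available only at continuity points of the difference.
  have hcts : ∀ y, ContinuousAt D y →
      |μ.real (Set.Iic y) - ν.real (Set.Iic y)| ≤ 1 / (2 * Real.pi) * ∫ s, g s := by
    intro y hy
    have e := hDint.fourierInv_fourier_eq hFint hy
    have e2 : ‖D y‖ = |μ.real (Set.Iic y) - ν.real (Set.Iic y)| := by
      simp only [hD, Complex.norm_real, Real.norm_eq_abs]
    rw [← e2, ← e, Real.fourierInv_eq']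
    calc _ ≤ ∫ w, ‖Complex.exp ((2 * Real.pi * inner ℝ w y : ℝ) * Complex.I) • 𝓕 D w‖ :=
          norm_integral_le_integral_norm _
      _ = ∫ w, ‖𝓕 D w‖ := by
          refine integral_congr_ae (.of_forall fun w => ?_)
          simp only [norm_smul, Complex.norm_exp_ofReal_mul_I, one_mul]
      _ ≤ ∫ w, g (-(2 * Real.pi) * w) := integral_mono_ae hFint.norm hg' hbound
      _ = _ := by
          rw [Measure.integral_comp_mul_left]
          simp [abs_of_pos Real.pi_pos]
  have hmono : ∀ η : Measure ℝ, [IsProbabilityMeasure η] →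
      Monotone fun y => η.real (Set.Iic y) := fun η _ a b hab =>
    measureReal_mono (Set.Iic_subset_Iic.2 hab)
  have hright : ∀ η : Measure ℝ, [IsProbabilityMeasure η] →
      ContinuousWithinAt (fun y => η.real (Set.Iic y)) (Set.Ioi x) x := fun η _ => by
    have := (cdf η).right_continuous x
    refine (this.mono Set.Ioi_subset_Ici_self).congr (fun y _ => ?_) ?_ <;>
      exact (cdf_eq_real η _).symm
  -- Monotone functions have countably many jumps, so common continuity points are dense; right
  -- continuity then carries the bound to every `x`.
  have hdense : Dense {y | ContinuousAt (fun y => μ.real (Set.Iic y)) y ∧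
      ContinuousAt (fun y => ν.real (Set.Iic y)) y} := by
    have := ((hmono μ).countable_not_continuousAt.union
      (hmono ν).countable_not_continuousAt).dense_compl ℝ
    refine this.mono fun y hy => ?_
    simpa [not_or] using hy
  have hlim : Filter.Tendsto (fun y => |μ.real (Set.Iic y) - ν.real (Set.Iic y)|)
      (nhdsWithin x (Set.Ioi x)) (nhds |μ.real (Set.Iic x) - ν.real (Set.Iic x)|) :=
    ((hright μ).sub (hright ν)).abs
  by_contra hcon
  rw [not_le] at hcon
  have hev := hlim.eventually (lt_mem_nhds hcon)
  obtain ⟨u, hu, hsub⟩ := mem_nhdsGT_iff_exists_Ioo_subset.1 hev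
  obtain ⟨y, hy, hyu⟩ := hdense.exists_mem_open isOpen_Ioo (Set.nonempty_Ioo.2 hu)
  exact absurd (hcts y (Complex.continuous_ofReal.continuousAt.comp (hy.1.sub hy.2)))
    (not_le.2 (hsub hyu))


/-! ### Characteristic function of weighted sums of centered chi-squares: expansion and decay. -/

/-- The logarithm of the characteristic function of `ξ² - 1` for a standard normal `ξ`. -/
noncomputable def logCharSq (u : ℝ) : ℂ :=
  -(1 / 2) * Complex.log (1 - 2 * u * Complex.I) - u * Complex.I

lemma one_sub_two_mul_I_mem_slitPlane (u : ℝ) : (1 - 2 * u * Complex.I) ∈ Complex.slitPlane := by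
  left; simp

lemma exp_sub_one_norm_le (z : ℂ) : ‖Complex.exp z - 1‖ ≤ ‖z‖ * Real.exp ‖z‖ := by
  simpa using Complex.norm_exp_sub_sum_le_norm_mul_exp z 1

lemma norm_exp_logCharSq (u : ℝ) :
    ‖Complex.exp (logCharSq u)‖ = (1 + 4 * u ^ 2) ^ (-(1 / 4) : ℝ) := by
  have h1 : ‖(1 - 2 * u * Complex.I : ℂ)‖ = (1 + 4 * u ^ 2) ^ (1 / 2 : ℝ) := by
    rw [Complex.norm_def, Real.sqrt_eq_rpow]
    congr 1
    simp [Complex.normSq_apply]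
    ring
  have hpos : 0 < 1 + 4 * u ^ 2 := by positivity
  have hre : (logCharSq u).re = Real.log (1 + 4 * u ^ 2) * (-(1 / 4)) := by
    have e : (logCharSq u).re = -(1 / 2) * (Complex.log (1 - 2 * u * Complex.I)).re := by
      simp [logCharSq]
    rw [e, Complex.log_re, h1, Real.log_rpow hpos]
    ring
  rw [Complex.norm_exp, hre, Real.rpow_def_of_pos hpos]

/-- The leading Taylor term of `logCharSq` is `-u ^ 2`; adding `u ^ 2` leaves a derivative of order
`u ^ 2`, and the denominator has modulus at least `1`. -/
lemma hasDerivAt_logCharSq_add_sq (u : ℝ) :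
    HasDerivAt (fun u : ℝ => logCharSq u + (u : ℂ) ^ 2)
      (-4 * Complex.I * u ^ 2 / (1 - 2 * u * Complex.I)) u := by
  have hz := one_sub_two_mul_I_mem_slitPlane u
  have hne : (1 - 2 * u * Complex.I : ℂ) ≠ 0 := Complex.slitPlane_ne_zero hz
  have h0 : HasDerivAt (fun u : ℝ => (u : ℂ)) 1 u := Complex.ofRealCLM.hasDerivAt
  have h1 : HasDerivAt (fun u : ℝ => (1 - 2 * u * Complex.I : ℂ)) (-(2 * Complex.I)) u := by
    exact (((h0.const_mul 2).mul_const Complex.I).const_sub 1).congr_deriv (by ring)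
  have h2 := ((h1.clog_real hz).const_mul (-(1 / 2))).sub (h0.mul_const Complex.I)
  refine (h2.add (h0.pow 2)).congr_deriv ?_
  have hw := mul_inv_cancel₀ hne
  simp only [div_eq_mul_inv]
  set w := (1 - 2 * u * Complex.I : ℂ)⁻¹
  push_cast
  linear_combination (Complex.I - 2 * u) * hw + 2 * u * w * Complex.I_sq

lemma norm_logCharSq_add_sq_le (u : ℝ) : ‖logCharSq u + (u : ℂ) ^ 2‖ ≤ 4 / 3 * |u| ^ 3 := by
  have hder : ∀ x : ℝ, ‖(-4 * Complex.I * x ^ 2 / (1 - 2 * x * Complex.I) : ℂ)‖ ≤ 4 * x ^ 2 := by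
    intro x
    rw [norm_div]
    have : 1 ≤ ‖(1 - 2 * x * Complex.I : ℂ)‖ := by
      calc (1 : ℝ) = |(1 - 2 * x * Complex.I : ℂ).re| := by simp
        _ ≤ _ := Complex.abs_re_le_norm _
    refine (div_le_self (norm_nonneg _) this).trans (le_of_eq ?_)
    simp
  have hB : ∀ x : ℝ, HasDerivAt (fun x : ℝ => 4 / 3 * x ^ 3) (4 * x ^ 2) x := by
    intro x
    refine (((hasDerivAt_id x).pow 3).const_mul (4 / 3)).congr_deriv ?_
    simp
    ring
  -- The sign `σ` reduces negative arguments to integrating the derivative bound over `[0, x]`.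
  have key : ∀ σ : ℝ, σ ^ 2 = 1 → ∀ x : ℝ, 0 ≤ x →
      ‖logCharSq (σ * x) + ((σ * x : ℝ) : ℂ) ^ 2‖ ≤ 4 / 3 * x ^ 3 := by
    intro σ hσ x hx
    have hσ' : |σ| = 1 := by
      rcases sq_eq_sq_iff_eq_or_eq_neg.1 (hσ.trans (one_pow 2).symm) with h | h <;> simp [h]
    have hf : ∀ y : ℝ, HasDerivAt
        (fun y : ℝ => logCharSq (σ * y) + ((σ * y : ℝ) : ℂ) ^ 2)
        (σ • (-4 * Complex.I * (σ * y : ℝ) ^ 2 / (1 - 2 * (σ * y : ℝ) * Complex.I))) y := by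
      intro y
      have := (hasDerivAt_logCharSq_add_sq (σ * y)).scomp y ((hasDerivAt_id y).const_mul σ)
      simpa [Function.comp_def] using this
    refine image_norm_le_of_norm_deriv_right_le_deriv_boundary (a := 0) (b := x)
      (fun y _ => (hf y).continuousAt.continuousWithinAt)
      (fun y _ => (hf y).hasDerivWithinAt) ?_ (fun y => hB y) ?_ ⟨hx, le_rfl⟩
    · simp [logCharSq]
    · intro y _
      rw [norm_smul, Real.norm_eq_abs, hσ', one_mul]
      refine (hder _).trans (le_of_eq ?_)
      rw [mul_pow, hσ, one_mul]
  rcases le_total 0 u with h | h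
  · have := key 1 (by norm_num) u h
    rw [abs_of_nonneg h]
    rwa [one_mul] at this
  · have := key (-1) (by norm_num) (-u) (by linarith)
    rw [abs_of_nonpos h]
    simpa using this

/-- This is a Gaussian integral with complex parameter `(1 - 2ui) / 2`. Its real part is positive,
so the square root is on the principal branch used in `logCharSq`. -/
lemma charFun_gaussian_sq (τ t : ℝ) :
    charFun ((gaussianReal 0 1).map fun x => τ * (x ^ 2 - 1)) t =
      Complex.exp (logCharSq (τ * t)) := by
  rw [charFun_apply_real, integral_map (by fun_prop) (by fun_prop),
    integral_gaussianReal_eq_integral_smul (by simp)]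
  set u := τ * t with hu
  have hz := one_sub_two_mul_I_mem_slitPlane u
  have hne : (1 - 2 * u * Complex.I : ℂ) ≠ 0 := Complex.slitPlane_ne_zero hz
  have e : ∀ x : ℝ, gaussianPDFReal 0 1 x •
      Complex.exp (t * ((τ * (x ^ 2 - 1) : ℝ) : ℂ) * Complex.I) =
      (((√(2 * Real.pi) : ℝ) : ℂ)⁻¹ * Complex.exp (-(u * Complex.I))) *
        Complex.exp (-((1 - 2 * u * Complex.I) / 2) * (x : ℂ) ^ 2) := by
    intro x
    simp only [gaussianPDFReal, NNReal.coe_one, mul_one, sub_zero, Complex.real_smul]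
    push_cast
    rw [mul_assoc, ← Complex.exp_add, mul_assoc (_)⁻¹ (Complex.exp _), ← Complex.exp_add]
    congr 2
    rw [hu]
    push_cast
    ring
  simp only [e]
  rw [integral_const_mul, integral_gaussian_complex (by simp)]
  have e2 : (Real.pi : ℂ) / ((1 - 2 * u * Complex.I) / 2) =
      ((2 * Real.pi : ℝ) : ℂ) * (1 - 2 * u * Complex.I)⁻¹ := by
    push_cast
    field_simp
  have h2pi : (0 : ℝ) < 2 * Real.pi := by positivity
  have hsqrt : ((√(2 * Real.pi) : ℝ) : ℂ) = Complex.exp (Real.log (2 * Real.pi) * (1 / 2)) := by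
    rw [Real.sqrt_eq_rpow, Real.rpow_def_of_pos h2pi]
    push_cast
    ring_nf
  rw [e2, Complex.cpow_def_of_ne_zero
    (mul_ne_zero (by exact_mod_cast h2pi.ne') (inv_ne_zero hne)),
    Complex.log_ofReal_mul h2pi (inv_ne_zero hne),
    Complex.log_inv _ (Complex.slitPlane_arg_ne_pi hz), hsqrt, ← Complex.exp_neg,
    ← Complex.exp_add, ← Complex.exp_add, logCharSq]
  congr 1
  ring

/-- The left side is the expansion of the product truncated after the second elementary symmetric
polynomial. The first conjunct says that this polynomial is nonnegative, which the induction needs.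
-/
lemma one_add_sum_add_le_prod {ι : Type*} (s : Finset ι) (a : ι → ℝ) (ha : ∀ i, 0 ≤ a i) :
    (∑ i ∈ s, a i ^ 2 ≤ (∑ i ∈ s, a i) ^ 2) ∧
    1 + ∑ i ∈ s, a i + ((∑ i ∈ s, a i) ^ 2 - ∑ i ∈ s, a i ^ 2) / 2 ≤ ∏ i ∈ s, (1 + a i) := by
  classical
  induction s using Finset.induction_on with
  | empty => simp
  | insert i s hi ih =>
    obtain ⟨h1, h2⟩ := ih
    have hs : 0 ≤ ∑ i ∈ s, a i := Finset.sum_nonneg fun i _ => ha i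
    rw [Finset.sum_insert hi, Finset.sum_insert hi, Finset.prod_insert hi]
    have h3 := mul_nonneg (ha i) hs
    refine ⟨by nlinarith, ?_⟩
    have h4 := mul_le_mul_of_nonneg_left h2 (by linarith [ha i] : 0 ≤ 1 + a i)
    have h5 := mul_nonneg (ha i) (sub_nonneg.2 h1)
    nlinarith

/-- Decay of the characteristic function of `∑ τ i * (ξ i ^ 2 - 1)`. -/
lemma norm_exp_sum_logCharSq_le {ι : Type*} [Fintype ι] (τ : ι → ℝ) {D k : ℝ}
    (hk : k = 2 * ∑ i, τ i ^ 2) (hkpos : 0 < k) (hD0 : 0 ≤ D) (hD : D < 1 / 2)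
    (hτ : ∀ i, τ i ^ 2 ≤ D * ∑ j, τ j ^ 2) {s : ℝ} (hs : s ≠ 0) :
    ‖Complex.exp (∑ i, logCharSq (τ i * s))‖ ≤
      (2 : ℝ) ^ (-(1 / 4) : ℝ) * k ^ (-(1 / 2) : ℝ) / √(1 - 2 * D) / |s| := by
  have hd : 0 < 1 - 2 * D := by linarith
  rw [Complex.exp_sum, norm_prod]
  simp only [norm_exp_logCharSq]
  rw [Real.finsetProd_rpow _ _ (fun i _ => by positivity)]
  have hs2 : 0 < s ^ 2 := by positivity
  -- Only the term of order `s ^ 4` is kept: its `-1/4` power decays like `1 / |s|`. Since no weight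
  -- exceeds the fraction `D` of the total, this term is at least `2 (k s ^ 2) ^ 2 (1 - D)`, and `(1
  -- - 2D) ^ 2 ≤ 1 - D`.
  have hprod : 2 * (k * s ^ 2 * (1 - 2 * D)) ^ 2 ≤ ∏ i, (1 + 4 * (τ i * s) ^ 2) := by
    obtain ⟨-, h⟩ := one_add_sum_add_le_prod Finset.univ (fun i => 4 * (τ i * s) ^ 2)
      (fun i => by positivity)
    refine le_trans ?_ h
    have e1 : ∑ i, 4 * (τ i * s) ^ 2 = 2 * k * s ^ 2 := by
      rw [hk, ← Finset.mul_sum]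
      simp only [mul_pow]
      rw [← Finset.sum_mul]
      ring
    have e2 : ∑ i, (4 * (τ i * s) ^ 2) ^ 2 ≤ D * (2 * k * s ^ 2) ^ 2 := by
      calc ∑ i, (4 * (τ i * s) ^ 2) ^ 2 ≤ ∑ i, (D * (2 * k * s ^ 2)) * (4 * (τ i * s) ^ 2) := by
            refine Finset.sum_le_sum fun i _ => ?_
            rw [sq (4 * (τ i * s) ^ 2)]
            refine mul_le_mul_of_nonneg_right ?_ (by positivity)
            have := mul_le_mul_of_nonneg_right (hτ i) hs2.le
            rw [hk]
            nlinarith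
        _ = _ := by rw [← Finset.mul_sum, e1]; ring
    rw [e1]
    have h0 : 0 ≤ 2 * k * s ^ 2 := by positivity
    have h3 : (k * s ^ 2 * (1 - 2 * D)) ^ 2 ≤ (k * s ^ 2) ^ 2 * (1 - D) := by
      rw [mul_pow]
      refine mul_le_mul_of_nonneg_left ?_ (by positivity)
      nlinarith
    nlinarith
  refine (Real.rpow_le_rpow_of_nonpos (by positivity) hprod (by norm_num)).trans (le_of_eq ?_)
  have hkr : (k * s ^ 2 * (1 - 2 * D)) ^ (-(1 / 2) : ℝ) =
      k ^ (-(1 / 2) : ℝ) / √(1 - 2 * D) / |s| := by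
    rw [Real.mul_rpow (by positivity) hd.le, Real.mul_rpow hkpos.le hs2.le,
      Real.rpow_neg hs2.le, Real.rpow_neg hd.le, ← Real.sqrt_eq_rpow, ← Real.sqrt_eq_rpow,
      Real.sqrt_sq_eq_abs]
    field_simp
  rw [Real.mul_rpow (by norm_num) (by positivity), ← Real.rpow_natCast,
    ← Real.rpow_mul (by positivity), show ((2 : ℕ) : ℝ) * -(1 / 4) = -(1 / 2) by norm_num, hkr]
  ring

/-- Closeness of the characteristic functions on `[-2π, 2π]`. -/
lemma norm_exp_sum_logCharSq_sub_le {ι : Type*} [Fintype ι] (τ : ι → ℝ) {b k x : ℝ}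
    (hk : k = 2 * ∑ i, τ i ^ 2) (hb : 0 ≤ b)
    (hx : x = 16 * Real.pi ^ 2 / 3 * ∑ i, |τ i| ^ 3 + b + Real.pi * |k - 1|)
    {s : ℝ} (hs : |s| ≤ 2 * Real.pi) :
    ‖Complex.exp (∑ i, logCharSq (τ i * s)) - Complex.exp (s * b * Complex.I - s ^ 2 / 2)‖ ≤
      |s| * (x * Real.exp (2 * Real.pi * x) * Real.exp (-(1 / 2) * s ^ 2)) := by
  have hpi := Real.pi_pos
  have hx0 : 0 ≤ x := by
    rw [hx]
    have : 0 ≤ ∑ i, |τ i| ^ 3 := Finset.sum_nonneg fun i _ => by positivity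
    positivity
  set z : ℂ := ∑ i, (logCharSq (τ i * s) + ((τ i * s : ℝ) : ℂ) ^ 2) - s * b * Complex.I
    - ((k - 1) * s ^ 2 / 2 : ℝ) with hz
  have e : ∑ i, logCharSq (τ i * s) = (s * b * Complex.I - s ^ 2 / 2) + z := by
    rw [hz, Finset.sum_add_distrib]
    have : ∑ i, ((τ i * s : ℝ) : ℂ) ^ 2 = ((k * s ^ 2 / 2 : ℝ) : ℂ) := by
      rw [hk]
      push_cast
      simp only [mul_pow]
      rw [← Finset.sum_mul]
      ring
    rw [this]
    push_cast
    ring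
  have hzle : ‖z‖ ≤ |s| * x := by
    have hs0 := abs_nonneg s
    have t1 : ‖∑ i, (logCharSq (τ i * s) + ((τ i * s : ℝ) : ℂ) ^ 2)‖ ≤
        4 / 3 * (∑ i, |τ i| ^ 3) * |s| ^ 3 := by
      refine (norm_sum_le _ _).trans ?_
      rw [mul_assoc, Finset.sum_mul, Finset.mul_sum]
      refine Finset.sum_le_sum fun i _ => ?_
      rw [← mul_pow, ← abs_mul]
      exact norm_logCharSq_add_sq_le _
    have t2 : ‖(s * b * Complex.I : ℂ)‖ = |s| * b := by
      simp [abs_of_nonneg hb]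
    have t3 : ‖(((k - 1) * s ^ 2 / 2 : ℝ) : ℂ)‖ = |k - 1| * |s| ^ 2 / 2 := by
      rw [Complex.norm_real, Real.norm_eq_abs, abs_div, abs_mul, abs_pow]
      norm_num
    have t4 := norm_sub_le (∑ i, (logCharSq (τ i * s) + ((τ i * s : ℝ) : ℂ) ^ 2)
      - s * b * Complex.I) (((k - 1) * s ^ 2 / 2 : ℝ) : ℂ)
    have t5 := norm_sub_le (∑ i, (logCharSq (τ i * s) + ((τ i * s : ℝ) : ℂ) ^ 2))
      (s * b * Complex.I)
    -- One factor `|s|` is kept to cancel the `1 / |s|` of the inversion bound; the others are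
    -- bounded by `2π`. Hence the constants `16π² / 3 = (4/3)(2π)²` and `π = 2π / 2`.
    have hsq : |s| ^ 2 ≤ 4 * Real.pi ^ 2 := by nlinarith
    have hT : 0 ≤ ∑ i, |τ i| ^ 3 := Finset.sum_nonneg fun i _ => by positivity
    have u1 : 4 / 3 * (∑ i, |τ i| ^ 3) * |s| ^ 3 ≤
        |s| * (16 * Real.pi ^ 2 / 3 * ∑ i, |τ i| ^ 3) := by
      have := mul_le_mul_of_nonneg_left hsq (mul_nonneg hT hs0)
      nlinarith
    have u2 : |k - 1| * |s| ^ 2 / 2 ≤ |s| * (Real.pi * |k - 1|) := by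
      have := mul_le_mul_of_nonneg_left hs (mul_nonneg (abs_nonneg (k - 1)) hs0)
      nlinarith
    rw [hx]
    have : |s| * (16 * Real.pi ^ 2 / 3 * ∑ i, |τ i| ^ 3 + b + Real.pi * |k - 1|) =
      |s| * (16 * Real.pi ^ 2 / 3 * ∑ i, |τ i| ^ 3) + |s| * b + |s| * (Real.pi * |k - 1|) := by
      ring
    linarith
  have hG : ‖Complex.exp (s * b * Complex.I - s ^ 2 / 2)‖ = Real.exp (-(1 / 2) * s ^ 2) := by
    rw [Complex.norm_exp]
    congr 1
    rw [show (s * b * Complex.I - s ^ 2 / 2 : ℂ) =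
      ((s * b : ℝ) : ℂ) * Complex.I - ((s ^ 2 / 2 : ℝ) : ℂ) by push_cast; ring]
    rw [Complex.sub_re, Complex.re_ofReal_mul, Complex.ofReal_re, Complex.I_re]
    ring
  rw [e, Complex.exp_add, ← mul_sub_one, norm_mul, hG]
  have h1 := exp_sub_one_norm_le z
  have h2 : ‖z‖ * Real.exp ‖z‖ ≤ |s| * x * Real.exp (2 * Real.pi * x) := by
    refine mul_le_mul hzle (Real.exp_le_exp.2 (hzle.trans ?_)) (Real.exp_pos _).le (by positivity)
    exact mul_le_mul_of_nonneg_right hs hx0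
  calc _ ≤ Real.exp (-(1 / 2) * s ^ 2) * (|s| * x * Real.exp (2 * Real.pi * x)) :=
        mul_le_mul_of_nonneg_left (h1.trans h2) (Real.exp_pos _).le
    _ = _ := by ring


/-! ### Integrating the bounds: Kolmogorov distance to the shifted normal law. -/

/-- `|t| ^ (-2)` restricted to `|t| > c`. -/
noncomputable def invSqTail (c t : ℝ) : ℝ := (Set.Ioi c).indicator (fun t => t ^ (-2 : ℝ)) |t|

lemma integrable_invSqTail {c : ℝ} (hc : 0 < c) : Integrable (invSqTail c) := by
  have h1 : Integrable ((Set.Ioi c).indicator fun t : ℝ => t ^ (-2 : ℝ)) :=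
    (integrable_indicator_iff measurableSet_Ioi).2
      (integrableOn_Ioi_rpow_of_lt (by norm_num) hc)
  have e : invSqTail c = fun t => (Set.Ioi c).indicator (fun t : ℝ => t ^ (-2 : ℝ)) t
      + (Set.Ioi c).indicator (fun t : ℝ => t ^ (-2 : ℝ)) (-t) := by
    ext t
    simp only [invSqTail, Set.indicator, Set.mem_Ioi]
    rcases le_total 0 t with h | h
    · rw [abs_of_nonneg h, if_neg (by linarith : ¬ c < -t), add_zero]
    · rw [abs_of_nonpos h, if_neg (by linarith : ¬ c < t), zero_add]
  rw [e]
  exact h1.add h1.comp_neg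

lemma integral_invSqTail {c : ℝ} (hc : 0 < c) : ∫ t, invSqTail c t = 2 / c := by
  simp only [invSqTail]
  rw [integral_comp_abs, setIntegral_indicator measurableSet_Ioi, Set.Ioi_inter_Ioi,
    max_eq_right hc.le, integral_Ioi_rpow_of_lt (by norm_num) hc]
  norm_num [Real.rpow_neg_one]
  rfl

lemma invSqTail_nonneg {c : ℝ} (t : ℝ) : 0 ≤ invSqTail c t := by
  rw [invSqTail]
  exact Set.indicator_apply_nonneg fun _ => Real.rpow_nonneg (abs_nonneg t) _

/-- Gives the Gaussian tail the same majorant `t ^ (-2)` as the other tail. The constant is the one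
whose integral against the prefactor `1 / (2π)` is exactly `R₃`. There is ample room: the
exponential series gives `t ^ 6 / 48 ≤ exp (t ^ 2 / 2)`, and `t > 6`. -/
lemma exp_neg_sq_div_le {t : ℝ} (ht : 2 * Real.pi < t) :
    Real.exp (-(1 / 2) * t ^ 2) / t ≤ (2 * Real.pi) ^ (-(3 / 2) : ℝ) / 2 * t ^ (-2 : ℝ) := by
  have hpi := Real.pi_gt_three
  have ht0 : 6 < t := by linarith
  have hpow : (1 : ℝ) / 32 ≤ (2 * Real.pi) ^ (-(3 / 2) : ℝ) := by
    calc (1 : ℝ) / 32 ≤ (10 : ℝ) ^ (-(3 / 2) : ℝ) := by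
          rw [show (-(3 / 2) : ℝ) = ((-3 : ℤ) : ℝ) * (1 / 2) by norm_num, Real.rpow_mul (by norm_num),
            Real.rpow_intCast, ← Real.sqrt_eq_rpow]
          apply Real.le_sqrt_of_sq_le
          norm_num
      _ ≤ _ := by
          refine Real.rpow_le_rpow_of_nonpos (by positivity) ?_ (by norm_num)
          linarith [Real.pi_lt_d2]
  have hexp : (t ^ 2 / 2) ^ 3 / 6 ≤ Real.exp (t ^ 2 / 2) := by
    have := Real.pow_div_factorial_le_exp (t ^ 2 / 2) (by positivity) 3
    simpa [Nat.factorial] using this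
  rw [show -(1 / 2) * t ^ 2 = -(t ^ 2 / 2) by ring, Real.exp_neg, Real.rpow_neg (by linarith : 0 ≤ t),
    Real.rpow_two]
  have hlow : t ^ 6 / 48 ≤ Real.exp (t ^ 2 / 2) := by
    refine le_trans (le_of_eq ?_) hexp
    ring
  have ht5 : 3072 ≤ t ^ 5 := by
    calc (3072 : ℝ) ≤ 6 ^ 5 := by norm_num
      _ ≤ t ^ 5 := by gcongr
  calc (Real.exp (t ^ 2 / 2))⁻¹ / t ≤ (t ^ 6 / 48)⁻¹ / t := by gcongr
    _ ≤ 1 / 32 / 2 * (t ^ 2)⁻¹ := by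
        rw [show (t ^ 6 / 48)⁻¹ / t = 48 / t ^ 5 * (t ^ 2)⁻¹ by field_simp]
        refine mul_le_mul_of_nonneg_right ?_ (by positivity)
        rw [div_le_iff₀ (by positivity)]
        linarith
    _ ≤ _ := by gcongr

/-- Kolmogorov distance between the law of `∑ τ i * (ξ i ^ 2 - 1)` and `N(b, 1)`. -/
theorem abs_cdf_sub_gaussianReal_le {ι : Type*} [Fintype ι] (τ : ι → ℝ) (μ : Measure ℝ)
    [IsProbabilityMeasure μ] (hint : Integrable id μ)
    (hchar : ∀ t, charFun μ t = Complex.exp (∑ i, logCharSq (τ i * t))) {D k b y : ℝ}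
    (hk : k = 2 * ∑ i, τ i ^ 2) (hkpos : 0 < k) (hD0 : 0 ≤ D) (hD : D < 1 / 2)
    (hτ : ∀ i, τ i ^ 2 ≤ D * ∑ j, τ j ^ 2) (hb : 0 ≤ b)
    (hy : y = 16 * Real.pi ^ 2 / 3 * ∑ i, |τ i| ^ 3 + b + Real.pi * |k - 1|) (x : ℝ) :
    |μ.real (Set.Iic x) - (gaussianReal b 1).real (Set.Iic x)| ≤
      KCI.Psi y + KCI.R₂ D * k ^ (-(1 / 2) : ℝ) + KCI.R₃ := by
  have hpi := Real.pi_pos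
  have h2pi : 0 < 2 * Real.pi := by positivity
  have hd : 0 < 1 - 2 * D := by linarith
  set C₁ := y * Real.exp (2 * Real.pi * y) with hC₁
  set C₂ := (2 : ℝ) ^ (-(1 / 4) : ℝ) * k ^ (-(1 / 2) : ℝ) / √(1 - 2 * D) with hC₂
  set C₃ := (2 * Real.pi) ^ (-(3 / 2) : ℝ) / 2 with hC₃
  have hy0 : 0 ≤ y := by
    rw [hy]
    have : 0 ≤ ∑ i, |τ i| ^ 3 := Finset.sum_nonneg fun i _ => by positivity
    positivity
  have hC₁0 : 0 ≤ C₁ := by positivity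
  have hC₂0 : 0 ≤ C₂ := by positivity
  have hC₃0 : 0 ≤ C₃ := by positivity
  have hg1 : Integrable fun s : ℝ => C₁ * Real.exp (-(1 / 2) * s ^ 2) :=
    (integrable_exp_neg_mul_sq (by norm_num)).const_mul _
  have hg2 : Integrable fun s : ℝ => (C₂ + C₃) * invSqTail (2 * Real.pi) s :=
    (integrable_invSqTail h2pi).const_mul _
  have hbound : ∀ s : ℝ, s ≠ 0 →
      ‖charFun μ s - charFun (gaussianReal b 1) s‖ / |s| ≤
        C₁ * Real.exp (-(1 / 2) * s ^ 2) + (C₂ + C₃) * invSqTail (2 * Real.pi) s := by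
    intro s hs
    have hs0 : 0 < |s| := abs_pos.2 hs
    rw [hchar, charFun_gaussianReal]
    simp only [NNReal.coe_one, Complex.ofReal_one, one_mul]
    -- Below the cut-off the two functions are compared; above it the triangle inequality bounds
    -- each separately.
    rcases le_or_gt |s| (2 * Real.pi) with h | h
    · have h1 := norm_exp_sum_logCharSq_sub_le τ hk hb hy h
      have h2 : 0 ≤ (C₂ + C₃) * invSqTail (2 * Real.pi) s :=
        mul_nonneg (by positivity) (invSqTail_nonneg s)
      rw [div_le_iff₀ hs0]
      nlinarith
    · have h1 := norm_exp_sum_logCharSq_le τ hk hkpos hD0 hD hτ hs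
      have h2 : ‖Complex.exp (s * b * Complex.I - s ^ 2 / 2)‖ = Real.exp (-(1 / 2) * |s| ^ 2) := by
        rw [Complex.norm_exp, sq_abs]
        congr 1
        rw [show (s * b * Complex.I - s ^ 2 / 2 : ℂ) =
          ((s * b : ℝ) : ℂ) * Complex.I - ((s ^ 2 / 2 : ℝ) : ℂ) by push_cast; ring]
        rw [Complex.sub_re, Complex.re_ofReal_mul, Complex.ofReal_re, Complex.I_re]
        ring
      have h3 := exp_neg_sq_div_le h
      have h4 : invSqTail (2 * Real.pi) s = |s| ^ (-2 : ℝ) := by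
        simp [invSqTail, h]
      have h5 : 0 ≤ C₁ * Real.exp (-(1 / 2) * s ^ 2) := by positivity
      have h6 : C₂ / |s| / |s| = C₂ * |s| ^ (-2 : ℝ) := by
        rw [Real.rpow_neg hs0.le, Real.rpow_two]
        field_simp
      calc _ ≤ (C₂ / |s| + Real.exp (-(1 / 2) * |s| ^ 2)) / |s| := by
            gcongr
            exact (norm_sub_le _ _).trans (add_le_add h1 h2.le)
        _ = C₂ / |s| / |s| + Real.exp (-(1 / 2) * |s| ^ 2) / |s| := by ring
        _ ≤ C₂ * |s| ^ (-2 : ℝ) + C₃ * |s| ^ (-2 : ℝ) := by rw [h6]; gcongr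
        _ ≤ _ := by rw [h4]; linarith
  have hmain := abs_cdf_sub_le μ (gaussianReal b 1) hint IsGaussian.integrable_id
    (hg1.add hg2) hbound x
  refine hmain.trans (le_of_eq ?_)
  simp only [Pi.add_apply]
  rw [integral_add hg1 hg2, integral_const_mul, integral_const_mul, integral_invSqTail h2pi,
    integral_gaussian, show Real.pi / (1 / 2) = 2 * Real.pi by ring]
  have e1 : 1 / (2 * Real.pi) * (C₁ * √(2 * Real.pi)) = KCI.Psi y := by
    rw [KCI.Psi, hC₁]
    have hsq : √(2 * Real.pi) * √(2 * Real.pi) = 2 * Real.pi := Real.mul_self_sqrt h2pi.le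
    have hne : √(2 * Real.pi) ≠ 0 := (Real.sqrt_pos.2 h2pi).ne'
    nth_rewrite 1 [← hsq]
    field_simp
  have e2 : 1 / (2 * Real.pi) * (C₂ * (2 / (2 * Real.pi))) =
      KCI.R₂ D * k ^ (-(1 / 2) : ℝ) := by
    rw [KCI.R₂, hC₂, show (-(5 / 4) : ℝ) = -(1 / 4) + -1 by norm_num,
      Real.rpow_add (by norm_num), Real.rpow_neg_one, Real.rpow_neg hpi.le, Real.rpow_two]
    field_simp
  have e3 : 1 / (2 * Real.pi) * (C₃ * (2 / (2 * Real.pi))) = KCI.R₃ := by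
    rw [KCI.R₃, hC₃, show (-(7 / 2) : ℝ) = -(3 / 2) + -2 by norm_num,
      Real.rpow_add h2pi, Real.rpow_neg h2pi.le 2, Real.rpow_two]
    field_simp
  rw [← e1, ← e2, ← e3]
  ring


/-! ### Moments and characteristic function of the weighted chi-square law. -/

/-- The substitution by `|x|` gives a Gamma value at a half-integer. For `j = 0` the truncated
subtraction yields `0‼ = 1`, which is still correct. -/
lemma integral_pow_even_gaussianReal (j : ℕ) :
    ∫ x, x ^ (2 * j) ∂(gaussianReal 0 1) = ((2 * j - 1).doubleFactorial : ℝ) := by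
  rw [integral_gaussianReal_eq_integral_smul (by simp)]
  have e : ∀ x : ℝ, gaussianPDFReal 0 1 x • x ^ (2 * j) =
      (√(2 * Real.pi))⁻¹ * (|x| ^ (2 * j : ℝ) * Real.exp (-(1 / 2) * |x| ^ (2 : ℝ))) := by
    intro x
    have h1 : |x| ^ (2 * j : ℝ) = x ^ (2 * j) := by
      rw [show (2 * j : ℝ) = ((2 * j : ℕ) : ℝ) by push_cast; ring, Real.rpow_natCast]
      exact (even_two_mul j).pow_abs x
    rw [h1, Real.rpow_two, sq_abs]
    simp only [gaussianPDFReal, NNReal.coe_one, mul_one, sub_zero, smul_eq_mul]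
    rw [show -x ^ 2 / 2 = -(1 / 2) * x ^ 2 by ring]
    ring
  simp only [e]
  rw [integral_const_mul, integral_comp_abs (f := fun x : ℝ =>
      x ^ (2 * j : ℝ) * Real.exp (-(1 / 2) * x ^ (2 : ℝ))),
    integral_rpow_mul_exp_neg_mul_rpow (by norm_num)
      (by have : (0 : ℝ) ≤ j := by positivity
          linarith) (by norm_num),
    show (2 * j + 1 : ℝ) / 2 = j + 1 / 2 by ring, Real.Gamma_nat_add_half]
  have h2 : ((1 : ℝ) / 2) ^ (-(j + 1 / 2) : ℝ) = 2 ^ j * √2 := by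
    rw [one_div, Real.inv_rpow (by norm_num), Real.rpow_neg (by norm_num), inv_inv,
      Real.rpow_add (by norm_num), Real.rpow_natCast, Real.sqrt_eq_rpow, one_div]
  rw [show (-(2 * j + 1) / 2 : ℝ) = -(j + 1 / 2) by ring, h2, Real.sqrt_mul (by norm_num)]
  have h3 : √Real.pi ≠ 0 := (Real.sqrt_pos.2 Real.pi_pos).ne'
  field_simp

lemma memLp_sq_sub_one_gaussianReal (τ : ℝ) :
    MemLp (fun x : ℝ => τ * (x ^ 2 - 1)) 3 (gaussianReal 0 1) := by
  have : ENNReal.HolderTriple 6 6 3 := ⟨by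
    rw [← two_mul, show (6 : ENNReal) = 2 * 3 by norm_num,
      ENNReal.mul_inv (by simp) (by simp), ← mul_assoc, ENNReal.mul_inv_cancel (by simp) (by simp),
      one_mul]⟩
  have h6 : MemLp id 6 (gaussianReal 0 1) := memLp_id_gaussianReal' 6 (by simp)
  have h3 : MemLp (fun x : ℝ => x ^ 2) 3 (gaussianReal 0 1) := by
    have := h6.mul (r := 3) h6
    refine this.congr_norm (by fun_prop) (.of_forall fun x => ?_)
    simp [sq]
  exact (h3.sub (memLp_const 1)).const_mul τ

lemma integral_sq_sub_one_gaussianReal :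
    ∫ x, (x ^ 2 - 1) ∂(gaussianReal 0 1) = 0 ∧ ∫ x, (x ^ 2 - 1) ^ 2 ∂(gaussianReal 0 1) = 2 ∧
      ∫ x, (x ^ 2 - 1) ^ 3 ∂(gaussianReal 0 1) = 8 := by
  have hi : ∀ j : ℕ, Integrable (fun x : ℝ => x ^ j) (gaussianReal 0 1) := fun j => by
    have h : MemLp id j (gaussianReal 0 1) := memLp_id_gaussianReal' j (by simp)
    have := h.integrable_norm_pow'
    refine this.congr' (by fun_prop) (.of_forall fun x => ?_)
    simp
  have h2 := integral_pow_even_gaussianReal 1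
  have h4 := integral_pow_even_gaussianReal 2
  have h6 := integral_pow_even_gaussianReal 3
  norm_num [Nat.doubleFactorial] at h2 h4 h6
  refine ⟨?_, ?_, ?_⟩
  · rw [integral_sub (hi 2) (integrable_const _), h2]
    simp
  · have e : ∀ x : ℝ, (x ^ 2 - 1) ^ 2 = x ^ 4 - 2 * x ^ 2 + 1 := fun x => by ring
    simp only [e]
    have h : Integrable (fun x : ℝ => x ^ 4 - 2 * x ^ 2) (gaussianReal 0 1) :=
      (hi 4).sub ((hi 2).const_mul 2)
    rw [integral_add h (integrable_const _), integral_sub (hi 4) ((hi 2).const_mul 2),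
      integral_const_mul, h2, h4]
    norm_num
  · have e : ∀ x : ℝ, (x ^ 2 - 1) ^ 3 = x ^ 6 - 3 * x ^ 4 + 3 * x ^ 2 - 1 := fun x => by ring
    simp only [e]
    have h : Integrable (fun x : ℝ => x ^ 6 - 3 * x ^ 4) (gaussianReal 0 1) :=
      (hi 6).sub ((hi 4).const_mul 3)
    have h' : Integrable (fun x : ℝ => x ^ 6 - 3 * x ^ 4 + 3 * x ^ 2) (gaussianReal 0 1) :=
      h.add ((hi 2).const_mul 3)
    rw [integral_sub h' (integrable_const _), integral_add h ((hi 2).const_mul 3),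
      integral_sub (hi 6) ((hi 4).const_mul 3), integral_const_mul, integral_const_mul, h2, h4, h6]
    norm_num

/-- The first three moments of a sum of independent centered variables. -/
lemma integral_sum_pow_of_iIndepFun {Ω ι : Type*} [MeasurableSpace Ω] {P : Measure Ω}
    [IsProbabilityMeasure P] {Y : ι → Ω → ℝ} (hind : iIndepFun Y P) (hmeas : ∀ i, Measurable (Y i))
    (hL : ∀ i, MemLp (Y i) 3 P) (h0 : ∀ i, ∫ ω, Y i ω ∂P = 0) (s : Finset ι) :
    ∫ ω, (∑ i ∈ s, Y i ω) ∂P = 0 ∧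
    ∫ ω, (∑ i ∈ s, Y i ω) ^ 2 ∂P = ∑ i ∈ s, ∫ ω, Y i ω ^ 2 ∂P ∧
    ∫ ω, (∑ i ∈ s, Y i ω) ^ 3 ∂P = ∑ i ∈ s, ∫ ω, Y i ω ^ 3 ∂P := by
  classical
  have hpow : ∀ {Z : Ω → ℝ}, MemLp Z 3 P → Integrable Z P ∧ Integrable (fun ω => Z ω ^ 2) P ∧
      Integrable (fun ω => Z ω ^ 3) P := fun {Z} hZ =>
    ⟨hZ.integrable (by norm_num), (hZ.mono_exponent (by norm_num)).integrable_sq, by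
      refine (hZ.integrable_norm_pow (by norm_num)).congr' (hZ.1.pow 3) (.of_forall fun x => ?_)
      simp⟩
  induction s using Finset.induction_on with
  | empty => simp
  | insert i s hi ih =>
    obtain ⟨ih1, ih2, ih3⟩ := ih
    set S : Ω → ℝ := fun ω => ∑ j ∈ s, Y j ω with hS
    have hSL : MemLp S 3 P := memLp_finsetSum s fun j _ => hL j
    have hSY : IndepFun (Y i) S P := by
      have := (hind.indepFun_finsetSum_of_notMem hmeas hi).symm
      convert this using 1
      ext ω
      simp [hS]
    obtain ⟨s1, s2, s3⟩ := hpow hSL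
    obtain ⟨y1, y2, y3⟩ := hpow (hL i)
    have i12 : IndepFun (Y i) (fun ω => S ω ^ 2) P :=
      hSY.comp measurable_id (measurable_id.pow_const 2)
    have i21 : IndepFun (fun ω => Y i ω ^ 2) S P :=
      hSY.comp (measurable_id.pow_const 2) measurable_id
    -- Each cross term up to order three contains a summand or partial sum to the first power, so it
    -- vanishes by independence and centering.
    have e11 := hSY.integral_fun_mul_eq_mul_integral y1.1 s1.1
    have e12 := i12.integral_fun_mul_eq_mul_integral y1.1 s2.1
    have e21 := i21.integral_fun_mul_eq_mul_integral y2.1 s1.1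
    have f11 : Integrable (fun ω => Y i ω * S ω) P := hSY.integrable_mul y1 s1
    have f12 : Integrable (fun ω => Y i ω * S ω ^ 2) P := i12.integrable_mul y1 s2
    have f21 : Integrable (fun ω => Y i ω ^ 2 * S ω) P := i21.integrable_mul y2 s1
    simp only [Finset.sum_insert hi]
    refine ⟨?_, ?_, ?_⟩
    · rw [integral_add y1 s1, h0, ih1, add_zero]
    · have e : ∀ ω, (Y i ω + S ω) ^ 2 = Y i ω ^ 2 + 2 * (Y i ω * S ω) + S ω ^ 2 :=
        fun ω => by ring
      have g : Integrable (fun ω => Y i ω ^ 2 + 2 * (Y i ω * S ω)) P := y2.add (f11.const_mul 2)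
      change ∫ ω, (Y i ω + S ω) ^ 2 ∂P = _
      simp only [e]
      rw [integral_add g s2, integral_add y2 (f11.const_mul 2),
        integral_const_mul, e11, h0, ih2]
      ring
    · have e : ∀ ω, (Y i ω + S ω) ^ 3 =
          Y i ω ^ 3 + 3 * (Y i ω ^ 2 * S ω) + 3 * (Y i ω * S ω ^ 2) + S ω ^ 3 :=
        fun ω => by ring
      have g : Integrable (fun ω => Y i ω ^ 3 + 3 * (Y i ω ^ 2 * S ω)) P :=
        y3.add (f21.const_mul 3)
      have g' : Integrable
          (fun ω => Y i ω ^ 3 + 3 * (Y i ω ^ 2 * S ω) + 3 * (Y i ω * S ω ^ 2)) P :=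
        g.add (f12.const_mul 3)
      change ∫ ω, (Y i ω + S ω) ^ 3 ∂P = _
      simp only [e]
      rw [integral_add g' s3, integral_add g (f12.const_mul 3),
        integral_add y3 (f21.const_mul 3), integral_const_mul, integral_const_mul, e21, e12, h0,
        ih1, ih3]
      ring

/-- The law of `∑ τ i * (ξ i ^ 2 - 1)` for i.i.d. standard normal `ξ i`. -/
noncomputable def chiSqLaw {ι : Type*} [Fintype ι] (τ : ι → ℝ) : Measure ℝ :=
  (Measure.pi fun _ : ι => gaussianReal 0 1).map fun e => ∑ i, τ i * (e i ^ 2 - 1)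

section chiSqLaw

variable {ι : Type*} [Fintype ι] (τ : ι → ℝ)

lemma measurable_chiSq : Measurable fun e : ι → ℝ => ∑ i, τ i * (e i ^ 2 - 1) := by fun_prop

instance : IsProbabilityMeasure (chiSqLaw τ) :=
  Measure.isProbabilityMeasure_map (measurable_chiSq τ).aemeasurable

lemma iIndepFun_chiSq : iIndepFun (fun i (e : ι → ℝ) => τ i * (e i ^ 2 - 1))
    (Measure.pi fun _ : ι => gaussianReal 0 1) :=
  iIndepFun_pi (X := fun i x => τ i * (x ^ 2 - 1)) fun i => by fun_prop

lemma memLp_chiSq (i : ι) : MemLp (fun e : ι → ℝ => τ i * (e i ^ 2 - 1)) 3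
    (Measure.pi fun _ : ι => gaussianReal 0 1) :=
  (memLp_sq_sub_one_gaussianReal (τ i)).comp_measurePreserving
    (measurePreserving_eval (fun _ : ι => gaussianReal 0 1) i)

lemma integrable_id_chiSqLaw : Integrable id (chiSqLaw τ) := by
  rw [chiSqLaw, integrable_map_measure (by fun_prop) (measurable_chiSq τ).aemeasurable]
  exact (memLp_finsetSum Finset.univ fun i _ => memLp_chiSq τ i).integrable (by norm_num)

lemma charFun_chiSqLaw (t : ℝ) :
    charFun (chiSqLaw τ) t = Complex.exp (∑ i, logCharSq (τ i * t)) := by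
  rw [chiSqLaw, (iIndepFun_chiSq τ).charFun_map_fun_sum_eq_prod
      (fun i => (by fun_prop : Measurable _).aemeasurable),
    Complex.exp_sum, Finset.prod_apply]
  refine Finset.prod_congr rfl fun i _ => ?_
  rw [← charFun_gaussian_sq]
  congr 1
  have hev : Measure.map (fun e : ι → ℝ => e i) (Measure.pi fun _ : ι => gaussianReal 0 1) =
      gaussianReal 0 1 := (measurePreserving_eval (fun _ : ι => gaussianReal 0 1) i).map_eq
  have := Measure.map_map (μ := Measure.pi fun _ : ι => gaussianReal 0 1)
    (g := fun x : ℝ => τ i * (x ^ 2 - 1)) (f := fun e : ι → ℝ => e i)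
    (by fun_prop) (measurable_pi_apply i)
  rw [hev] at this
  exact this.symm

lemma integral_pow_chiSqLaw : ∫ y, y ∂(chiSqLaw τ) = 0 ∧
    ∫ y, y ^ 2 ∂(chiSqLaw τ) = 2 * ∑ i, τ i ^ 2 ∧
    ∫ y, y ^ 3 ∂(chiSqLaw τ) = 8 * ∑ i, τ i ^ 3 := by
  have heval : ∀ (i : ι) (j : ℕ), ∫ e : ι → ℝ, (τ i * (e i ^ 2 - 1)) ^ j
      ∂(Measure.pi fun _ : ι => gaussianReal 0 1) =
      τ i ^ j * ∫ x, (x ^ 2 - 1) ^ j ∂(gaussianReal 0 1) := by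
    intro i j
    conv_rhs => rw [← integral_const_mul,
      ← (measurePreserving_eval (fun _ : ι => gaussianReal 0 1) i).map_eq,
      integral_map (measurable_pi_apply i).aemeasurable (by fun_prop)]
    simp [mul_pow]
  obtain ⟨g1, g2, g3⟩ := integral_sq_sub_one_gaussianReal
  obtain ⟨h1, h2, h3⟩ := integral_sum_pow_of_iIndepFun (iIndepFun_chiSq τ)
    (fun i => by fun_prop) (memLp_chiSq τ) (fun i => by
      have := heval i 1
      simpa [g1] using this) Finset.univ
  simp only [chiSqLaw]
  have hm := (measurable_chiSq τ).aemeasurable (μ := Measure.pi fun _ : ι => gaussianReal 0 1)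
  refine ⟨?_, ?_, ?_⟩
  · rw [integral_map hm (by fun_prop), h1]
  · rw [integral_map hm (by fun_prop), h2]
    simp only [heval, g2, ← Finset.sum_mul]
    ring
  · rw [integral_map hm (by fun_prop), h3]
    simp only [heval, g3, ← Finset.sum_mul]
    ring

lemma variance_chiSqLaw : Var[id; chiSqLaw τ] = 2 * ∑ i, τ i ^ 2 := by
  obtain ⟨h1, h2, -⟩ := integral_pow_chiSqLaw τ
  rw [variance_of_integral_eq_zero (X := id) (by fun_prop) h1]
  exact h2

lemma skewness_chiSqLaw :
    KCI.skewness (chiSqLaw τ) = 8 * (∑ i, τ i ^ 3) / (2 * ∑ i, τ i ^ 2) ^ (3 / 2 : ℝ) := by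
  obtain ⟨h1, -, h3⟩ := integral_pow_chiSqLaw τ
  rw [KCI.skewness, variance_chiSqLaw, h1]
  simp only [sub_zero, h3]

lemma chiSqLaw_map_mul (c : ℝ) :
    (chiSqLaw τ).map (fun y => c * y) = chiSqLaw fun i => c * τ i := by
  rw [chiSqLaw, Measure.map_map (by fun_prop) (measurable_chiSq τ), chiSqLaw]
  congr 1
  ext e
  simp [Finset.mul_sum, mul_assoc]

end chiSqLaw


/-! ### Singular values and diagonalization of the quadratic form. -/

section Hermitian

open Matrix

variable {n : ℕ} {M : Matrix (Fin n) (Fin n) ℝ}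

/-- Both sides are the roots of one characteristic polynomial, since `MᴴM = U D² U*` and `charpoly
(AB) = charpoly (BA)`. The equality is one of multisets because the two enumerations need not agree
index by index; symmetric functions suffice below. -/
lemma map_eigenvalues_conjTranspose_mul_self (hM : M.IsHermitian) :
    Multiset.map (isHermitian_conjTranspose_mul_self M).eigenvalues Finset.univ.val =
      Multiset.map (fun r => hM.eigenvalues r ^ 2) Finset.univ.val := by
  have h1 := (isHermitian_conjTranspose_mul_self M).roots_charpoly_eq_eigenvalues
  have hU : (star (hM.eigenvectorUnitary : Matrix (Fin n) (Fin n) ℝ)) *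
      (hM.eigenvectorUnitary : Matrix (Fin n) (Fin n) ℝ) = 1 := Unitary.coe_star_mul_self _
  have h2 : Mᴴ * M = (hM.eigenvectorUnitary : Matrix (Fin n) (Fin n) ℝ) *
      (diagonal (fun r => hM.eigenvalues r ^ 2) *
        star (hM.eigenvectorUnitary : Matrix (Fin n) (Fin n) ℝ)) := by
    have hs := hM.spectral_theorem
    rw [Unitary.conjStarAlgAut_apply] at hs
    rw [hM.eq]
    refine (congrArg₂ (· * ·) hs hs).trans ?_
    have hd : diagonal (fun r => hM.eigenvalues r ^ 2) =
        diagonal (RCLike.ofReal ∘ hM.eigenvalues) * (diagonal (RCLike.ofReal ∘ hM.eigenvalues) :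
          Matrix (Fin n) (Fin n) ℝ) := by
      rw [diagonal_mul_diagonal]
      simp [sq]
    rw [hd]
    simp only [Matrix.mul_assoc]
    rw [← Matrix.mul_assoc (star _) (hM.eigenvectorUnitary : Matrix (Fin n) (Fin n) ℝ),
      hU, Matrix.one_mul]
  have h3 := congrArg (fun A : Matrix (Fin n) (Fin n) ℝ => A.charpoly.roots) h2
  simp only [charpoly_mul_comm _ (_ * star _), Matrix.mul_assoc, hU, Matrix.mul_one] at h3
  rw [h1, charpoly_diagonal,
    Polynomial.roots_prod _ _
      (Finset.prod_ne_zero_iff.2 fun _ _ => Polynomial.X_sub_C_ne_zero _)] at h3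
  simp only [Polynomial.roots_X_sub_C, Multiset.bind_singleton] at h3
  exact h3

lemma sum_singVal (hM : M.IsHermitian) (f : ℝ → ℝ) :
    ∑ r, f (KCI.singVal M r) = ∑ r, f |hM.eigenvalues r| := by
  have h := congrArg (fun s : Multiset ℝ => (s.map fun x => f (√x)).sum)
    (map_eigenvalues_conjTranspose_mul_self hM)
  simp only [Multiset.map_map, Function.comp_def, Real.sqrt_sq_eq_abs] at h
  exact h

lemma schatten_two_sq (hM : M.IsHermitian) : KCI.schatten 2 M ^ 2 = ∑ r, hM.eigenvalues r ^ 2 := by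
  rw [KCI.schatten, sum_singVal hM fun x => x ^ (2 : ℝ)]
  simp only [Real.rpow_ofNat, sq_abs]
  rw [← Real.sqrt_eq_rpow, Real.sq_sqrt (Finset.sum_nonneg fun r _ => sq_nonneg _)]

lemma schatten_two_pow_three (hM : M.IsHermitian) :
    KCI.schatten 2 M ^ 3 = (∑ r, hM.eigenvalues r ^ 2) ^ (3 / 2 : ℝ) := by
  rw [KCI.schatten, sum_singVal hM fun x => x ^ (2 : ℝ)]
  simp only [Real.rpow_ofNat, sq_abs]
  rw [← Real.rpow_natCast, ← Real.rpow_mul (Finset.sum_nonneg fun r _ => sq_nonneg _)]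
  norm_num

lemma schatten_three_pow_three (hM : M.IsHermitian) :
    KCI.schatten 3 M ^ 3 = ∑ r, |hM.eigenvalues r| ^ 3 := by
  rw [KCI.schatten, sum_singVal hM fun x => x ^ (3 : ℝ)]
  simp only [Real.rpow_ofNat]
  rw [← Real.rpow_natCast, ← Real.rpow_mul (Finset.sum_nonneg fun r _ => by positivity)]
  norm_num

lemma eigenvalues_sq_le_schattenTop_sq (hM : M.IsHermitian) (r : Fin n) :
    hM.eigenvalues r ^ 2 ≤ KCI.schattenTop M ^ 2 := by
  have hmem : hM.eigenvalues r ^ 2 ∈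
      Multiset.map (isHermitian_conjTranspose_mul_self M).eigenvalues Finset.univ.val := by
    rw [map_eigenvalues_conjTranspose_mul_self hM]
    exact Multiset.mem_map_of_mem _ (Finset.mem_univ_val r)
  obtain ⟨j, -, hj⟩ := Multiset.mem_map.1 hmem
  have h1 : |hM.eigenvalues r| = KCI.singVal M j := by
    rw [KCI.singVal, hj, Real.sqrt_sq_eq_abs]
  have h2 : KCI.singVal M j ≤ KCI.schattenTop M :=
    le_ciSup (f := fun r => KCI.singVal M r) (Set.finite_range _).bddAbove j
  rw [← sq_abs]
  exact pow_le_pow_left₀ (abs_nonneg _) (h1.trans_le h2) 2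

lemma sum_eigenvalues_sq_pos (hM : M.IsHermitian) (h0 : M ≠ 0) : 0 < ∑ r, hM.eigenvalues r ^ 2 := by
  have hne : hM.eigenvalues ≠ 0 := fun h => h0 (hM.eigenvalues_eq_zero_iff.1 h)
  obtain ⟨r, hr⟩ := Function.ne_iff.1 hne
  exact Finset.sum_pos' (fun r _ => sq_nonneg _) ⟨r, Finset.mem_univ r, sq_pos_of_ne_zero hr⟩

lemma eigenvalues_sq_le_delta_mul (hM : M.IsHermitian) (h0 : M ≠ 0) (r : Fin n) :
    hM.eigenvalues r ^ 2 ≤ KCI.delta M * ∑ j, hM.eigenvalues j ^ 2 := by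
  rw [KCI.delta, schatten_two_sq hM, div_mul_cancel₀ _ (sum_eigenvalues_sq_pos hM h0).ne']
  exact eigenvalues_sq_le_schattenTop_sq hM r

lemma delta_nonneg : 0 ≤ KCI.delta M := by
  rw [KCI.delta]
  positivity

lemma wildBootstrap_sum_eigenvectorBasis (hM : M.IsHermitian) (x : Fin n → ℝ) :
    KCI.wildBootstrap M (fun i => (∑ r, x r • hM.eigenvectorBasis r : EuclideanSpace ℝ (Fin n)) i) =
      ∑ r, hM.eigenvalues r / n * (x r ^ 2 - 1) := by
  set u : EuclideanSpace ℝ (Fin n) := ∑ r, x r • hM.eigenvectorBasis r with hu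
  have hMu : M *ᵥ u.ofLp =
      (∑ r, (x r * hM.eigenvalues r) • hM.eigenvectorBasis r : EuclideanSpace ℝ (Fin n)).ofLp := by
    rw [hu, WithLp.ofLp_sum, WithLp.ofLp_sum, mulVec_sum]
    refine Finset.sum_congr rfl fun r _ => ?_
    rw [WithLp.ofLp_smul, WithLp.ofLp_smul, mulVec_smul, hM.mulVec_eigenvectorBasis, smul_smul]
  have hquad : ∑ i, ∑ j, M i j * (u i * u j) = ∑ r, hM.eigenvalues r * x r ^ 2 := by
    have h1 : ∑ i, ∑ j, M i j * (u i * u j) = u.ofLp ⬝ᵥ (M *ᵥ u.ofLp) := by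
      simp only [dotProduct, mulVec, Finset.mul_sum]
      exact Finset.sum_congr rfl fun i _ => Finset.sum_congr rfl fun j _ => by ring
    rw [h1, hMu]
    have h2 : ∀ y z : EuclideanSpace ℝ (Fin n), y.ofLp ⬝ᵥ z.ofLp = inner ℝ y z := fun y z => by
      simp [PiLp.inner_apply, dotProduct, mul_comm]
    rw [h2, hu, hM.eigenvectorBasis.orthonormal.inner_sum]
    exact Finset.sum_congr rfl fun r _ => by simp; ring
  -- The trace is the centering term: subtracting `∑ λ r` turns each `λ r x r ^ 2` into `λ r (x r ^
  -- 2 - 1)`.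
  have htr : ∑ i, M i i = ∑ r, hM.eigenvalues r := by
    have := hM.trace_eq_sum_eigenvalues
    simpa [trace] using this
  have hsplit : ∑ i, ∑ j, M i j * (u i * u j - if i = j then 1 else 0) =
      ∑ i, ∑ j, M i j * (u i * u j) - ∑ i, M i i := by
    simp [mul_sub, Finset.sum_sub_distrib]
  rw [KCI.wildBootstrap]
  rw [hsplit, hquad, htr, ← Finset.sum_sub_distrib, Finset.mul_sum]
  exact Finset.sum_congr rfl fun r _ => by ring

lemma measurable_wildBootstrap_uncurry : Measurable fun p : (Fin n → Fin n → ℝ) × (Fin n → ℝ) =>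
    KCI.wildBootstrap (Matrix.of p.1) p.2 := by
  simp only [KCI.wildBootstrap, Matrix.of_apply]
  fun_prop

/-- In the eigenbasis of its matrix, the centered Gaussian quadratic form is a weighted sum of
independent centered chi-square variables. -/
lemma map_wildBootstrap (hM : M.IsHermitian) :
    (Measure.pi fun _ : Fin n => gaussianReal 0 1).map (KCI.wildBootstrap M) =
      chiSqLaw fun r => hM.eigenvalues r / n := by
  -- Rotation invariance: i.i.d. normal coordinates in the eigenbasis produce the same standard
  -- Gaussian vector in law.
  have h1 := map_pi_eq_stdGaussian (ι := Fin n)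
  rw [stdGaussian_eq_map_pi_orthonormalBasis hM.eigenvectorBasis] at h1
  have hmeas : Measurable fun u : EuclideanSpace ℝ (Fin n) => KCI.wildBootstrap M u.ofLp := by
    simp only [KCI.wildBootstrap]
    fun_prop
  have h2 := congrArg (Measure.map fun u : EuclideanSpace ℝ (Fin n) =>
    KCI.wildBootstrap M u.ofLp) h1
  rw [Measure.map_map hmeas (by fun_prop), Measure.map_map hmeas (by fun_prop)] at h2
  rw [chiSqLaw]
  refine h2.trans (congrArg (fun f => Measure.map f _) (funext fun x => ?_))
  exact wildBootstrap_sum_eigenvectorBasis hM x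

end Hermitian


/-! ### Skewness identity and normal approximation for a fixed matrix. -/

lemma map_mul_real_Iic (μ : Measure ℝ) {c : ℝ} (hc : 0 < c) (x : ℝ) :
    (μ.map fun y => c * y).real (Set.Iic x) = μ.real (Set.Iic (x / c)) := by
  rw [map_measureReal_apply (by fun_prop) measurableSet_Iic]
  congr 1
  ext y
  simp [le_div_iff₀ hc, mul_comm]

lemma two_mul_div_sq_rpow {S c : ℝ} (hS : 0 ≤ S) (hc : 0 < c) :
    (2 * (S / c ^ 2)) ^ (3 / 2 : ℝ) = 2 * √2 * S ^ (3 / 2 : ℝ) / c ^ 3 := by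
  rw [Real.mul_rpow (by norm_num) (by positivity), Real.div_rpow hS (by positivity),
    ← Real.rpow_natCast c 2, ← Real.rpow_mul hc.le,
    show ((2 : ℕ) : ℝ) * (3 / 2) = ((3 : ℕ) : ℝ) by norm_num, Real.rpow_natCast,
    show (3 / 2 : ℝ) = 1 + 1 / 2 by norm_num, Real.rpow_add (by norm_num : (0 : ℝ) < 2),
    Real.rpow_one, ← Real.sqrt_eq_rpow]
  ring

section WildBootstrap

variable {n : ℕ} {M : Matrix (Fin n) (Fin n) ℝ}

/-- Positive semidefiniteness is essential here: skewness involves `∑ λ r ^ 3`, the Schatten norm `∑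
|λ r| ^ 3`. -/
lemma R₁_eq_skewness (hM : M.PosSemidef) (h0 : M ≠ 0) :
    KCI.R₁ M = 2 * Real.pi ^ 2 / 3 * KCI.skewness
      ((Measure.pi fun _ : Fin n => gaussianReal 0 1).map (KCI.wildBootstrap M)) := by
  have hS := sum_eigenvalues_sq_pos hM.isHermitian h0
  have hn : (0 : ℝ) < n := by
    rcases Nat.eq_zero_or_pos n with rfl | h
    · exact absurd (Subsingleton.elim M 0) h0
    · exact_mod_cast h
  rw [map_wildBootstrap hM.isHermitian, skewness_chiSqLaw, KCI.R₁,
    schatten_two_pow_three hM.isHermitian, schatten_three_pow_three hM.isHermitian]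
  have habs : ∀ r, |hM.isHermitian.eigenvalues r| = hM.isHermitian.eigenvalues r :=
    fun r => abs_of_nonneg (hM.eigenvalues_nonneg r)
  simp only [habs, div_pow, ← Finset.sum_div]
  set S := ∑ r, hM.isHermitian.eigenvalues r ^ 2
  set T := ∑ r, hM.isHermitian.eigenvalues r ^ 3
  rw [two_mul_div_sq_rpow hS.le hn]
  have hS' : S ^ (3 / 2 : ℝ) ≠ 0 := (Real.rpow_pos_of_pos hS _).ne'
  have h2 : √2 * √2 = (2 : ℝ) := Real.mul_self_sqrt (by norm_num)
  have h2' : √2 ≠ (0 : ℝ) := by positivity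
  field_simp
  linear_combination 4 * T * h2

/-- Normal approximation of the centered Gaussian quadratic form of a symmetric matrix. -/
theorem kolmogorovDist_map_wildBootstrap_le (hM : M.IsHermitian) (h0 : M ≠ 0)
    (hδ : KCI.delta M < 1 / 2) {m v : ℝ} (hm : 0 ≤ m) (hv : 0 < v) {μ ν : Measure ℝ}
    (hμ : μ = (Measure.pi fun _ : Fin n => gaussianReal 0 1).map (KCI.wildBootstrap M))
    (hν : ν = (gaussianReal m v.toNNReal).map fun z : ℝ => n * z) :
    KCI.kolmogorovDist μ ν ≤
      KCI.Psi (KCI.R₁ M * KCI.varMismatch n μ v ^ (3 / 2 : ℝ) + KCI.meanShift m v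
          + Real.pi * |KCI.varMismatch n μ v - 1|)
        + KCI.R₂ (KCI.delta M) * KCI.varMismatch n μ v ^ (-(1 / 2) : ℝ) + KCI.R₃ := by
  have hS := sum_eigenvalues_sq_pos hM h0
  have hn : (0 : ℝ) < n := by
    rcases Nat.eq_zero_or_pos n with rfl | h
    · exact absurd (Subsingleton.elim M 0) h0
    · exact_mod_cast h
  have hsv : 0 < √v := Real.sqrt_pos.2 hv
  have hsv2 : √v ^ 2 = v := Real.sq_sqrt hv.le
  -- Kolmogorov distance is invariant under positive scaling; dividing by `n √v` makes the target
  -- variance `1` and its mean `b`.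
  set c : ℝ := n * √v with hc
  have hcpos : 0 < c := by positivity
  set τ : Fin n → ℝ := fun r => hM.eigenvalues r / n / c with hτ
  set k := KCI.varMismatch n μ v with hk
  have hμ' : μ = (chiSqLaw τ).map fun y => c * y := by
    rw [hμ, map_wildBootstrap hM, chiSqLaw_map_mul]
    congr 1
    ext r
    simp only [hτ]
    field_simp
  have hν' : ν = (gaussianReal (KCI.meanShift m v) 1).map fun y => c * y := by
    rw [hν, gaussianReal_map_const_mul, gaussianReal_map_const_mul, KCI.meanShift]
    congr 1
    · rw [hc]
      field_simp
    · ext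
      simp [hc, mul_pow, hsv2, hv.le]
  have hτsq : ∑ r, τ r ^ 2 = (∑ r, hM.eigenvalues r ^ 2) / (n * c) ^ 2 := by
    simp only [hτ, div_div, div_pow, ← Finset.sum_div]
  have hkeq : k = 2 * ∑ r, τ r ^ 2 := by
    rw [hk, KCI.varMismatch, hμ, map_wildBootstrap hM, variance_chiSqLaw, hτsq]
    simp only [div_pow, ← Finset.sum_div]
    rw [show (n : ℝ) ^ 2 * v = c ^ 2 by rw [hc, mul_pow, hsv2]]
    field_simp
  have hτpos : 0 < ∑ r, τ r ^ 2 := by rw [hτsq]; positivity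
  have hkpos : 0 < k := by rw [hkeq]; positivity
  -- The powers of `n c` cancel; the constant is `(4/3) √2 · 2√2 = 16/3`.
  have hR₁ : KCI.R₁ M * k ^ (3 / 2 : ℝ) = 16 * Real.pi ^ 2 / 3 * ∑ r, |τ r| ^ 3 := by
    have e1 : ∑ r, |τ r| ^ 3 = (∑ r, |hM.eigenvalues r| ^ 3) / (n * c) ^ 3 := by
      simp only [hτ, div_div, abs_div, div_pow, ← Finset.sum_div,
        abs_of_pos (mul_pos hn hcpos)]
    have hnc : 0 < n * c := mul_pos hn hcpos
    rw [hkeq, hτsq, e1, KCI.R₁, schatten_two_pow_three hM, schatten_three_pow_three hM]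
    set S := ∑ r, hM.eigenvalues r ^ 2
    set T := ∑ r, |hM.eigenvalues r| ^ 3
    rw [two_mul_div_sq_rpow hS.le hnc]
    have hS' : S ^ (3 / 2 : ℝ) ≠ 0 := (Real.rpow_pos_of_pos hS _).ne'
    have h2 : √2 * √2 = (2 : ℝ) := Real.mul_self_sqrt (by norm_num)
    calc _ = 8 / 3 * (√2 * √2) * Real.pi ^ 2 * T / (n * c) ^ 3 := by field_simp; ring
      _ = _ := by rw [h2]; ring
  have hτle : ∀ r, τ r ^ 2 ≤ KCI.delta M * ∑ j, τ j ^ 2 := fun r => by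
    rw [hτsq, ← mul_div_assoc, hτ]
    simp only [div_div, div_pow]
    gcongr
    exact eigenvalues_sq_le_delta_mul hM h0 r
  have hb : 0 ≤ KCI.meanShift m v := div_nonneg hm hsv.le
  refine ciSup_le fun x => ?_
  rw [hμ', hν', map_mul_real_Iic _ hcpos, map_mul_real_Iic _ hcpos]
  exact abs_cdf_sub_gaussianReal_le τ (chiSqLaw τ) (integrable_id_chiSqLaw τ) (charFun_chiSqLaw τ)
    hkeq hkpos delta_nonneg hδ hτle hb (by rw [hR₁]) _

end WildBootstrap


/-! ### Conditional laws under independence. -/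

/-- If `X` and `E` are independent, the conditional law of `F (X, E)` given `X = x` is the law of
`F (x, E)`. -/
lemma condDistrib_comp_of_indepFun {α β γ : Type*} [MeasurableSpace α] [MeasurableSpace β]
    [MeasurableSpace γ] {μ : Measure α} [IsProbabilityMeasure μ] {X : α → β} {E : α → γ}
    (hX : AEMeasurable X μ) (hE : AEMeasurable E μ) (hind : IndepFun X E μ)
    {F : β × γ → ℝ} (hF : Measurable F) :
    ∀ᵐ x ∂(μ.map X), condDistrib (fun a => F (X a, E a)) X μ x =
      (μ.map E).map fun e => F (x, e) := by
  have : IsProbabilityMeasure (μ.map E) := Measure.isProbabilityMeasure_map hE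
  have : IsProbabilityMeasure (μ.map X) := Measure.isProbabilityMeasure_map hX
  set κ : Kernel β ℝ := (Kernel.id ×ₖ Kernel.const β (μ.map E)).map F with hκ
  have hκx : ∀ x, κ x = (μ.map E).map fun e => F (x, e) := fun x => by
    rw [hκ, Kernel.map_apply _ hF, Kernel.prod_apply, Kernel.id_apply, Kernel.const_apply,
      Measure.dirac_prod, Measure.map_map hF (by fun_prop)]
    rfl
  have : IsMarkovKernel κ := Kernel.IsMarkovKernel.map _ hF
  have hY : AEMeasurable (fun a => F (X a, E a)) μ := hF.comp_aemeasurable (hX.prodMk hE)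
  -- The joint law disintegrates along `κ`, and disintegrations are almost everywhere unique.
  have hjoint : μ.map (fun a => (X a, F (X a, E a))) = μ.map X ⊗ₘ κ := by
    have hG : Measurable fun p : β × γ => (p.1, F p) := by fun_prop
    have e1 : μ.map (fun a => (X a, F (X a, E a))) =
        ((μ.map X).prod (μ.map E)).map fun p => (p.1, F p) := by
      rw [← (indepFun_iff_map_prod_eq_prod_map_map hX hE).1 hind,
        AEMeasurable.map_map_of_aemeasurable hG.aemeasurable (hX.prodMk hE)]
      rfl
    rw [e1]
    ext s hs
    rw [Measure.map_apply hG hs, Measure.prod_apply (hG hs), Measure.compProd_apply hs]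
    refine lintegral_congr fun x => ?_
    rw [hκx, Measure.map_apply (by fun_prop) (measurable_prodMk_left hs)]
    rfl
  filter_upwards [condDistrib_ae_eq_of_measure_eq_compProd X hY hjoint] with x hx
  rw [hx, hκx]

/-! ### Nonnegative mean of a positive definite kernel. -/

/-- For Bochner integrable `Φ` the double integral is `‖∫ Φ‖ ^ 2`. Only the kernel is assumed
integrable, so `Φ` is first cut off to `{‖Φ‖ ≤ N}`; this merely replaces some kernel values by `0`,
and dominated convergence removes the cut-off. -/
lemma integral_inner_self_nonneg_of_complete {𝒳 E : Type*} [MeasurableSpace 𝒳]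
    [NormedAddCommGroup E] [InnerProductSpace ℝ E] [CompleteSpace E] (P : Measure 𝒳)
    [IsProbabilityMeasure P] {Φ : 𝒳 → E} (hΦ : StronglyMeasurable Φ)
    (hint : Integrable (fun z : 𝒳 × 𝒳 => inner ℝ (Φ z.1) (Φ z.2)) (P.prod P)) :
    0 ≤ ∫ z : 𝒳 × 𝒳, inner ℝ (Φ z.1) (Φ z.2) ∂(P.prod P) := by
  set Ψ : ℕ → 𝒳 → E := fun N => {x | ‖Φ x‖ ≤ N}.indicator Φ with hΨ
  have hmeas : ∀ N, StronglyMeasurable (Ψ N) := fun N =>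
    hΦ.indicator (measurableSet_le hΦ.norm.measurable measurable_const)
  have hbound : ∀ N x, ‖Ψ N x‖ ≤ N := fun N x => by
    by_cases hx : ‖Φ x‖ ≤ N <;> simp [hΨ, hx]
  have hΨint : ∀ N, Integrable (Ψ N) P := fun N =>
    Integrable.of_bound (hmeas N).aestronglyMeasurable N (.of_forall (hbound N))
  have hprodmeas : ∀ N, AEStronglyMeasurable (fun z : 𝒳 × 𝒳 => inner ℝ (Ψ N z.1) (Ψ N z.2))
      (P.prod P) := fun N =>
    (((hmeas N).comp_measurable measurable_fst).inner
      ((hmeas N).comp_measurable measurable_snd)).aestronglyMeasurable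
  have hle : ∀ N (z : 𝒳 × 𝒳), ‖inner ℝ (Ψ N z.1) (Ψ N z.2)‖ ≤ ‖inner ℝ (Φ z.1) (Φ z.2)‖ := by
    intro N z
    by_cases h1 : ‖Φ z.1‖ ≤ N <;> by_cases h2 : ‖Φ z.2‖ ≤ N <;> simp [hΨ, h1, h2]
  have hnonneg : ∀ N, 0 ≤ ∫ z : 𝒳 × 𝒳, inner ℝ (Ψ N z.1) (Ψ N z.2) ∂(P.prod P) := by
    intro N
    rw [integral_prod _ (hint.mono (hprodmeas N) (.of_forall (hle N)))]
    simp only [integral_inner (hΨint N)]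
    simp only [real_inner_comm (∫ y, Ψ N y ∂P)]
    rw [integral_inner (hΨint N)]
    exact real_inner_self_nonneg
  refine ge_of_tendsto' (tendsto_integral_of_dominated_convergence
    (fun z : 𝒳 × 𝒳 => ‖inner ℝ (Φ z.1) (Φ z.2)‖) hprodmeas hint.norm
    (fun N => .of_forall (hle N)) (.of_forall fun z => ?_)) hnonneg
  obtain ⟨N₁, h₁⟩ := exists_nat_ge ‖Φ z.1‖
  obtain ⟨N₂, h₂⟩ := exists_nat_ge ‖Φ z.2‖
  refine tendsto_const_nhds.congr' ?_
  filter_upwards [Filter.eventually_ge_atTop (max N₁ N₂)] with N hN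
  have h1 : ‖Φ z.1‖ ≤ N := h₁.trans (by exact_mod_cast (le_max_left _ _).trans hN)
  have h2 : ‖Φ z.2‖ ≤ N := h₂.trans (by exact_mod_cast (le_max_right _ _).trans hN)
  simp [hΨ, h1, h2]

/-- An integrable positive definite kernel has nonnegative mean. -/
lemma integral_inner_self_nonneg {𝒳 E : Type*} [MeasurableSpace 𝒳]
    [NormedAddCommGroup E] [InnerProductSpace ℝ E] (P : Measure 𝒳)
    [IsProbabilityMeasure P] {Φ : 𝒳 → E} (hΦ : StronglyMeasurable Φ)
    (hint : Integrable (fun z : 𝒳 × 𝒳 => inner ℝ (Φ z.1) (Φ z.2)) (P.prod P)) :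
    0 ≤ ∫ z : 𝒳 × 𝒳, inner ℝ (Φ z.1) (Φ z.2) ∂(P.prod P) := by
  -- The feature space used below is an algebraic tensor product, hence only pre-Hilbert; the
  -- embedding into its completion preserves inner products.
  have h := integral_inner_self_nonneg_of_complete P
    (Φ := fun x => (Φ x : UniformSpace.Completion E))
    ((UniformSpace.Completion.continuous_coe E).comp_stronglyMeasurable hΦ)
  simp only [UniformSpace.Completion.inner_coe] at h
  exact h hint

/-! ### The product kernel as an inner product of tensor features. -/

open scoped TensorProduct

/-- Makes the tensor feature map strongly measurable; continuity comes from `‖x ⊗ y‖ = ‖x‖ ‖y‖`. -/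
lemma continuous_tmul (E F : Type*) [NormedAddCommGroup E] [InnerProductSpace ℝ E]
    [NormedAddCommGroup F] [InnerProductSpace ℝ F] :
    Continuous fun p : E × F => p.1 ⊗ₜ[ℝ] p.2 :=
  ((TensorProduct.mk ℝ E F).mkContinuous₂ 1 fun x y => by simp).continuous₂

section Kernel

variable {𝒜 ℬ 𝒞 HA HB HC : Type*}
    [NormedAddCommGroup HA] [InnerProductSpace ℝ HA]
    [NormedAddCommGroup HB] [InnerProductSpace ℝ HB]
    [NormedAddCommGroup HC] [InnerProductSpace ℝ HC]
    (φA : 𝒜 → HA) (φB : ℬ → HB) (φC : 𝒞 → HC) (muA : 𝒞 → HA) (muB : 𝒞 → HB)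

/-- The feature map of the kernel `KCI.hHat`. -/
noncomputable def hHatFeature (x : 𝒜 × ℬ × 𝒞) : HC ⊗[ℝ] (HA ⊗[ℝ] HB) :=
  φC x.2.2 ⊗ₜ[ℝ] ((φA x.1 - muA x.2.2) ⊗ₜ[ℝ] (φB x.2.1 - muB x.2.2))

lemma hHat_eq_inner (x x' : 𝒜 × ℬ × 𝒞) : KCI.hHat φA φB φC muA muB x x' =
    inner ℝ (hHatFeature φA φB φC muA muB x) (hHatFeature φA φB φC muA muB x') := by
  simp [KCI.hHat, hHatFeature, mul_assoc]

lemma posSemidef_gram_hHat {n : ℕ} (x : Fin n → 𝒜 × ℬ × 𝒞) :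
    (KCI.gram (KCI.hHat φA φB φC muA muB) x).PosSemidef := by
  have e : KCI.gram (KCI.hHat φA φB φC muA muB) x =
      Matrix.gram ℝ fun i => hHatFeature φA φB φC muA muB (x i) := by
    ext i j
    exact hHat_eq_inner φA φB φC muA muB (x i) (x j)
  exact e ▸ Matrix.posSemidef_gram ℝ fun i => hHatFeature φA φB φC muA muB (x i)

lemma isHermitian_gramOff_hHat {n : ℕ} (x : Fin n → 𝒜 × ℬ × 𝒞) :
    (KCI.gramOff (KCI.hHat φA φB φC muA muB) x).IsHermitian := by
  refine Matrix.IsHermitian.ext fun i j => ?_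
  simp only [KCI.gramOff, Matrix.of_apply, star_trivial, ne_comm (a := j), KCI.hHat,
    real_inner_comm (φC (x i).2.2), real_inner_comm (φA (x i).1 - _),
    real_inner_comm (φB (x i).2.1 - _)]

variable [MeasurableSpace 𝒜] [MeasurableSpace ℬ] [MeasurableSpace 𝒞]
  {φA φB φC muA muB}

lemma stronglyMeasurable_hHatFeature
    (hφA : StronglyMeasurable φA) (hφB : StronglyMeasurable φB) (hφC : StronglyMeasurable φC)
    (hmuA : StronglyMeasurable muA) (hmuB : StronglyMeasurable muB) :
    StronglyMeasurable (hHatFeature φA φB φC muA muB) := by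
  have hc : Measurable fun x : 𝒜 × ℬ × 𝒞 => x.2.2 := by fun_prop
  have h1 : StronglyMeasurable fun x : 𝒜 × ℬ × 𝒞 => φA x.1 - muA x.2.2 :=
    (hφA.comp_measurable measurable_fst).sub (hmuA.comp_measurable hc)
  have h2 : StronglyMeasurable fun x : 𝒜 × ℬ × 𝒞 => φB x.2.1 - muB x.2.2 :=
    (hφB.comp_measurable (measurable_fst.comp measurable_snd)).sub (hmuB.comp_measurable hc)
  exact (continuous_tmul _ _).comp_stronglyMeasurable ((hφC.comp_measurable hc).prodMk
    ((continuous_tmul _ _).comp_stronglyMeasurable (h1.prodMk h2)))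

lemma measurable_hHat
    (hφA : StronglyMeasurable φA) (hφB : StronglyMeasurable φB) (hφC : StronglyMeasurable φC)
    (hmuA : StronglyMeasurable muA) (hmuB : StronglyMeasurable muB) :
    Measurable fun z : (𝒜 × ℬ × 𝒞) × (𝒜 × ℬ × 𝒞) => KCI.hHat φA φB φC muA muB z.1 z.2 := by
  simp only [hHat_eq_inner]
  have h := stronglyMeasurable_hHatFeature hφA hφB hφC hmuA hmuB
  exact ((h.comp_measurable measurable_fst).inner (𝕜 := ℝ)
    (h.comp_measurable measurable_snd)).measurable

lemma population_hHat_nonneg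
    (hφA : StronglyMeasurable φA) (hφB : StronglyMeasurable φB) (hφC : StronglyMeasurable φC)
    (hmuA : StronglyMeasurable muA) (hmuB : StronglyMeasurable muB)
    (P : Measure (𝒜 × ℬ × 𝒞)) [IsProbabilityMeasure P]
    (hL2 : MemLp (fun z : (𝒜 × ℬ × 𝒞) × (𝒜 × ℬ × 𝒞) => KCI.hHat φA φB φC muA muB z.1 z.2) 2
      (P.prod P)) :
    0 ≤ KCI.population (KCI.hHat φA φB φC muA muB) P := by
  have hint := hL2.integrable (by norm_num)
  simp only [KCI.population, hHat_eq_inner] at hint ⊢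
  exact integral_inner_self_nonneg P (stronglyMeasurable_hHatFeature hφA hφB hφC hmuA hmuB) hint

end Kernel

/-! ### Conditional law of the bootstrap variable and conclusion. -/

/-- The zero diagonal annihilates the centering term, so the second convention is an instance of the
first with another symmetric matrix. -/
lemma wildBootstrapOff_gramOff {𝒳 : Type*} (h : 𝒳 → 𝒳 → ℝ) {n : ℕ} (x : Fin n → 𝒳)
    (e : Fin n → ℝ) :
    KCI.wildBootstrapOff (KCI.gramOff h x) e = KCI.wildBootstrap (KCI.gramOff h x) e := by
  simp only [KCI.wildBootstrapOff, KCI.wildBootstrap, KCI.gramOff, Matrix.of_apply]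
  congr 1
  refine Finset.sum_congr rfl fun i _ => Finset.sum_congr rfl fun j _ => ?_
  by_cases hij : i = j <;> simp [hij, mul_assoc]

/-- The conditional law of the wild bootstrap variable given its matrix. -/
lemma condLaw_wildBootstrap {Ω 𝒳 : Type*} [MeasurableSpace Ω] [MeasurableSpace 𝒳] {ρ : Measure Ω}
    [IsProbabilityMeasure ρ] {n : ℕ} {X : Ω → 𝒳} (hX : AEMeasurable X ρ) {ε : Fin n → Ω → ℝ}
    (hε : ∀ i, HasLaw (ε i) (gaussianReal 0 1) ρ) (hεindep : iIndepFun ε ρ)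
    (hXε : IndepFun X (fun ω i => ε i ω) ρ) {G : 𝒳 → Fin n → Fin n → ℝ} (hG : Measurable G)
    {H : Ω → Matrix (Fin n) (Fin n) ℝ} (hH : ∀ ω, H ω = Matrix.of (G (X ω))) {Y : Ω → ℝ}
    (hY : ∀ ω, Y ω = KCI.wildBootstrap (H ω) fun i => ε i ω) :
    ∀ᵐ ω ∂ρ, KCI.condLaw Y H ρ ω =
      (Measure.pi fun _ : Fin n => gaussianReal 0 1).map (KCI.wildBootstrap (H ω)) := by
  have hεm : AEMeasurable (fun ω i => ε i ω) ρ := aemeasurable_pi_lambda _ fun i =>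
    (hε i).aemeasurable
  have hεlaw : ρ.map (fun ω i => ε i ω) = Measure.pi fun _ : Fin n => gaussianReal 0 1 := by
    rw [(iIndepFun_iff_map_fun_eq_pi_map fun i => (hε i).aemeasurable).1 hεindep]
    simp only [(hε _).map_eq]
  have hGX : AEMeasurable (fun ω => G (X ω)) ρ := hG.comp_aemeasurable hX
  -- The conditioning variable is the matrix `G (X ω)`, not the sample; it inherits independence
  -- from the multipliers.
  have hmain := ae_of_ae_map hGX (condDistrib_comp_of_indepFun hGX hεm
    (hXε.comp hG measurable_id) measurable_wildBootstrap_uncurry)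
  have hHG : (fun (ω' : Ω) (i j : Fin n) => H ω' i j) = fun ω => G (X ω) := by
    ext ω i j
    rw [hH, Matrix.of_apply]
  have hYF : Y = fun ω => KCI.wildBootstrap (Matrix.of (G (X ω))) fun i => ε i ω := by
    ext ω
    rw [hY, hH]
  filter_upwards [hmain] with ω hω
  rw [KCI.condLaw, hHG, congrFun hHG ω, hH, hYF]
  rw [hεlaw] at hω
  exact hω


theorem mainTheorem4
    {𝒜 ℬ 𝒞 HA HB HC Ω Ω' : Type*}
    [MeasurableSpace 𝒜] [MeasurableSpace ℬ] [MeasurableSpace 𝒞]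
    [NormedAddCommGroup HA] [InnerProductSpace ℝ HA] [CompleteSpace HA]
    [NormedAddCommGroup HB] [InnerProductSpace ℝ HB] [CompleteSpace HB]
    [NormedAddCommGroup HC] [InnerProductSpace ℝ HC] [CompleteSpace HC]
    [MeasurableSpace Ω] [MeasurableSpace Ω']
    -- feature maps of the three kernels and the estimated conditional mean embeddings
    (φA : 𝒜 → HA) (φB : ℬ → HB) (φC : 𝒞 → HC) (muA : 𝒞 → HA) (muB : 𝒞 → HB)
    (hφA : StronglyMeasurable φA) (hφB : StronglyMeasurable φB) (hφC : StronglyMeasurable φC)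
    (hmuA : StronglyMeasurable muA) (hmuB : StronglyMeasurable muB)
    -- the law of `(A, B, C)`, under the null
    (P : Measure (𝒜 × ℬ × 𝒞)) [IsProbabilityMeasure P]
    (hnull : KCI.CondIndepGiven P)
    (h : 𝒜 × ℬ × 𝒞 → 𝒜 × ℬ × 𝒞 → ℝ) (hh : h = KCI.hHat φA φB φC muA muB)
    (hL2 : MemLp (fun z => h z.1 z.2) 2 (P.prod P))
    -- the test sample and the Gaussian multipliers
    (ρ : Measure Ω) [IsProbabilityMeasure ρ] (n : ℕ)
    (X : Fin n → Ω → 𝒜 × ℬ × 𝒞) (hX : ∀ i, HasLaw (X i) P ρ) (hXindep : iIndepFun X ρ)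
    (ε : Fin n → Ω → ℝ) (hε : ∀ i, HasLaw (ε i) (gaussianReal 0 1) ρ) (hεindep : iIndepFun ε ρ)
    (hXε : IndepFun (fun ω i => X i ω) (fun ω i => ε i ω) ρ)
    -- mean and variance of the statistic
    (m v : ℝ) (hm : m = KCI.population h P)
    (hv : v = Var[fun ω => KCI.uStat h (fun i => X i ω); ρ]) (hvpos : 0 < v)
    -- the moment-matched normal variable
    (ρ' : Measure Ω') [IsProbabilityMeasure ρ']
    (Z : Ω' → ℝ) (hZ : HasLaw Z (gaussianReal m v.toNNReal) ρ')
    -- the full kernel matrix with the centered quadratic form,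
    -- and the off-diagonal kernel matrix with the off-diagonal sum
    (H Hoff : Ω → Matrix (Fin n) (Fin n) ℝ)
    (hH : ∀ ω, H ω = KCI.gram h (fun i => X i ω))
    (hHoff : ∀ ω, Hoff ω = KCI.gramOff h (fun i => X i ω))
    (Y Yoff : Ω → ℝ)
    (hY : ∀ ω, Y ω = KCI.wildBootstrap (H ω) (fun i => ε i ω))
    (hYoff : ∀ ω, Yoff ω = KCI.wildBootstrapOff (Hoff ω) (fun i => ε i ω)) :
    (∀ᵐ ω ∂ρ, H ω ≠ 0 → KCI.delta (H ω) < 1 / 2 →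
      KCI.R₁ (H ω) = 2 * Real.pi ^ 2 / 3 * KCI.skewness (KCI.condLaw Y H ρ ω) ∧
      KCI.kolmogorovDist (KCI.condLaw Y H ρ ω) (ρ'.map fun ω' => n * Z ω') ≤
        KCI.Psi (KCI.R₁ (H ω) * KCI.varMismatch n (KCI.condLaw Y H ρ ω) v ^ (3 / 2 : ℝ)
            + KCI.meanShift m v
            + Real.pi * |KCI.varMismatch n (KCI.condLaw Y H ρ ω) v - 1|)
          + KCI.R₂ (KCI.delta (H ω)) * KCI.varMismatch n (KCI.condLaw Y H ρ ω) v ^ (-(1 / 2) : ℝ)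
          + KCI.R₃) ∧
    (∀ᵐ ω ∂ρ, Hoff ω ≠ 0 → KCI.delta (Hoff ω) < 1 / 2 →
      KCI.kolmogorovDist (KCI.condLaw Yoff Hoff ρ ω) (ρ'.map fun ω' => n * Z ω') ≤
        KCI.Psi (KCI.R₁ (Hoff ω) * KCI.varMismatch n (KCI.condLaw Yoff Hoff ρ ω) v ^ (3 / 2 : ℝ)
            + KCI.meanShift m v
            + Real.pi * |KCI.varMismatch n (KCI.condLaw Yoff Hoff ρ ω) v - 1|)
          + KCI.R₂ (KCI.delta (Hoff ω))
            * KCI.varMismatch n (KCI.condLaw Yoff Hoff ρ ω) v ^ (-(1 / 2) : ℝ)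
          + KCI.R₃) := by
  subst hh
  have hm0 : 0 ≤ m := hm ▸ population_hHat_nonneg hφA hφB hφC hmuA hmuB P hL2
  have hXm : AEMeasurable (fun ω i => X i ω) ρ := aemeasurable_pi_lambda _ fun i =>
    (hX i).aemeasurable
  have hhm := measurable_hHat hφA hφB hφC hmuA hmuB
  have hentry : ∀ i j : Fin n, Measurable fun x : Fin n → 𝒜 × ℬ × 𝒞 =>
      KCI.hHat φA φB φC muA muB (x i) (x j) := fun i j =>
    hhm.comp (f := fun x : Fin n → 𝒜 × ℬ × 𝒞 => (x i, x j))
      ((measurable_pi_apply i).prodMk (measurable_pi_apply j))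
  have hν : (ρ'.map fun ω' => n * Z ω') =
      (gaussianReal m v.toNNReal).map fun z : ℝ => n * z := by
    rw [← hZ.map_eq, AEMeasurable.map_map_of_aemeasurable (by fun_prop) hZ.aemeasurable]
    rfl
  refine ⟨?_, ?_⟩
  · have hG : Measurable fun (x : Fin n → 𝒜 × ℬ × 𝒞) (i j : Fin n) =>
        KCI.hHat φA φB φC muA muB (x i) (x j) :=
      measurable_pi_lambda _ fun i => measurable_pi_lambda _ fun j => hentry i j
    filter_upwards [condLaw_wildBootstrap hXm hε hεindep hXε hG hH hY] with ω hω h0 hδ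
    have hpsd : (H ω).PosSemidef := hH ω ▸ posSemidef_gram_hHat φA φB φC muA muB _
    refine ⟨hω ▸ R₁_eq_skewness hpsd h0, ?_⟩
    exact kolmogorovDist_map_wildBootstrap_le hpsd.isHermitian h0 hδ hm0 hvpos hω hν
  · have hG : Measurable fun (x : Fin n → 𝒜 × ℬ × 𝒞) (i j : Fin n) =>
        if i ≠ j then KCI.hHat φA φB φC muA muB (x i) (x j) else 0 := by
      refine measurable_pi_lambda _ fun i => measurable_pi_lambda _ fun j => ?_
      by_cases hij : i = j
      · simp [hij]
      · simpa [hij] using hentry i j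
    have hYoff' : ∀ ω, Yoff ω = KCI.wildBootstrap (Hoff ω) fun i => ε i ω := fun ω => by
      rw [hYoff, hHoff, wildBootstrapOff_gramOff]
    filter_upwards [condLaw_wildBootstrap hXm hε hεindep hXε hG hHoff hYoff'] with ω hω h0 hδ
    -- Removing the diagonal can destroy positive semidefiniteness; the distance bound needs only
    -- symmetry.
    have hherm : (Hoff ω).IsHermitian := hHoff ω ▸ isHermitian_gramOff_hHat φA φB φC muA muB _
    exact kolmogorovDist_map_wildBootstrap_le hherm h0 hδ hm0 hvpos hω hν
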